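/- Let $\mathbb N$ denote the set of positive integers. Let $G$ be a group generated by a finite set $X$. For $k\in\mathbb N$, let $\mathcal S_k$ be the set of all elements of the free group $F(X)$ of length at most $k$ (with respect to $X\cup X^{-1}$) that represent $1$ in $G$, and let $\langle\langle \mathcal S_k\rangle\rangle$ be its normal closure in $F(X)$. For $w\in\langle\langle \mathcal S_m\rangle\rangle$, let $Area_{\mathcal S_m}(w)$ be the least $\ell\ge 0$ such that $w=\prod_{i=1}^{\ell} f_i^{-1}R_i^{\varepsilon_i}f_i$ for some $f_i\in F(X)$, $R_i\in\mathcal S_m$, $\varepsilon_i=\pm1$. The isoperimetric spectrum of $G$ with respect to $X$ is $$f_{G,X}(k,m,n)=\max\{Area_{\mathcal S_m}(w)\mid w\in\langle\langle \mathcal S_k\rangle\rangle,\ \|w\|\le n\},\qquad (k,m,n)\in\mathbb N^3,\ m\ge k,$$ where $\|w\|$ is the length of $w$. For real-valued functions $f,h$ of triples $(k,m,n)\in\mathbb N^3$ with $m\ge k$, write $f\preccurlyeq h$ if there is $C\in\mathbb N$ such that $$f(k,Cm,n)\le C\,h(Ck,m,Cn)+C\frac nm+C$$ for all $(k,m,n)\in\mathbb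 N^3$ with $m\ge Ck$. An asymptotic cone of $G$ is the ultralimit along $\omega$ of the pointed metric spaces $(G,\lambda_i d_Y,e_i)_{i\in I}$, where $d_Y$ is the word metric of a finite generating set $Y$ of $G$, $\omega$ is a non-principal ultrafilter on a set $I$, $(\lambda_i)_{i\in I}$ are positive real numbers with $\lim_\omega\lambda_i=0$, and $(e_i)_{i\in I}$ is a family of elements of $G$. That is, it consists of the families $(x_i)_{i\in I}$ in $G$ for which $\lambda_i d_Y(x_i,e_i)$ is bounded for $\omega$-almost all $i$, with metric $\lim_\omega\lambda_i d_Y(x_i,y_i)$, two families at distance $0$ being identified. **Proposition.** Let $G$ be a finitely presented group, and let $X$ be a finite generating set of $G$. Suppose that there exists a non-decreasing function $g\colon\mathbb Q_{>0}\to\mathbb R$ such that $f_{G,X}(k,m,n)\preccurlyeq g(n/m)$, the right-hand side being considered as a function of $(k,m,n)$ independent of $k$. Then all asymptotic cones of $G$ (for all $Y$, $I$, $\omega$, $(\lambda_i)$, $(e_i)$) are simply connected. -/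

import Mathlib

open Filter Topology

noncomputable section

namespace IsoSpectrum

/-! ### Area and the isoperimetric spectrum -/

/-- `w` is a product of `l` factors of the form `f⁻¹ * R ^ (±1) * f` with `R ∈ S`. -/
def IsProdOfConj {F : Type*} [Group F] (S : Set F) (w : F) (l : ℕ) : Prop :=
  ∃ L : List F, L.length = l ∧
    (∀ c ∈ L, ∃ f : F, ∃ R ∈ S, c = f⁻¹ * R * f ∨ c = f⁻¹ * R⁻¹ * f) ∧ L.prod = w

/-- `Area_S(w)`: the least number of factors in a decomposition of `w` as a product of conjugates
of elements of `S` and of their inverses. It is only used for `w` in the normal closure of `S`,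
where such decompositions exist (see `exists_isProdOfConj`). -/
def area {F : Type*} [Group F] (S : Set F) (w : F) : ℕ :=
  sInf {l | IsProdOfConj S w l}

theorem exists_isProdOfConj {F : Type*} [Group F] {S : Set F} {w : F}
    (hw : w ∈ Subgroup.normalClosure S) : ∃ l, IsProdOfConj S w l := by
  unfold Subgroup.normalClosure at hw
  induction hw using Subgroup.closure_induction with
  | mem x hx =>
    obtain ⟨R, hR, hc⟩ := Group.mem_conjugatesOfSet_iff.1 hx
    obtain ⟨c, hc⟩ := isConj_iff.1 hc
    refine ⟨1, [x], rfl, ?_, by simp⟩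
    intro y hy
    rw [List.mem_singleton] at hy
    exact ⟨c⁻¹, R, hR, Or.inl (by rw [hy, ← hc, inv_inv])⟩
  | one => exact ⟨0, [], rfl, by simp, rfl⟩
  | mul x y _ _ hx hy =>
    obtain ⟨a, L, rfl, hL, rfl⟩ := hx
    obtain ⟨b, L', rfl, hL', rfl⟩ := hy
    refine ⟨_, L ++ L', rfl, ?_, by simp⟩
    intro c hc
    rcases List.mem_append.1 hc with h | h
    exacts [hL c h, hL' c h]
  | inv x _ hx =>
    obtain ⟨a, L, rfl, hL, rfl⟩ := hx
    refine ⟨_, (L.map fun x => x⁻¹).reverse, rfl, ?_, by rw [List.prod_inv_reverse]⟩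
    intro c hc
    rw [List.mem_reverse, List.mem_map] at hc
    obtain ⟨d, hd, rfl⟩ := hc
    obtain ⟨f, R, hR, h | h⟩ := hL d hd
    · exact ⟨f, R, hR, Or.inr (by rw [h]; group)⟩
    · exact ⟨f, R, hR, Or.inl (by rw [h]; group)⟩

variable {G : Type*} [Group G]

/-- The canonical homomorphism `F(X) → G` from the free group with basis `X ⊆ G`. -/
def eval (X : Finset G) : FreeGroup X →* G :=
  FreeGroup.lift (fun x : X => (x : G))

open Classical in
/-- The length `‖w‖` of (the reduced word representing) an element of `F(X)`. -/
def len {G : Type*} (X : Finset G) (w : FreeGroup X) : ℕ := w.norm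

/-- `S_k`: the words over `X ∪ X⁻¹` of length at most `k` that represent `1` in `G`,
as a subset of `F(X)`. -/
def relators (X : Finset G) (k : ℕ) : Set (FreeGroup X) :=
  {w | eval X w = 1 ∧ len X w ≤ k}

/-- The isoperimetric spectrum
`f_{G,X}(k,m,n) = max {Area_{S_m}(w) | w ∈ ⟨⟨S_k⟩⟩, ‖w‖ ≤ n}`, meaningful for `k ≤ m`;
the supremum is a maximum by `spectrum_isGreatest`. -/
def spectrum (X : Finset G) (k m n : ℕ) : ℕ :=
  sSup (area (relators X m) '' {w | w ∈ Subgroup.normalClosure (relators X k) ∧ len X w ≤ n})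

theorem finite_len_le {G : Type*} (X : Finset G) (n : ℕ) : {w : FreeGroup X | len X w ≤ n}.Finite := by
  classical
  have h : {l : List (X × Bool) | l.length ≤ n}.Finite := List.finite_length_le _ n
  refine (h.image FreeGroup.mk).subset ?_
  intro w hw
  refine ⟨w.toWord, ?_, FreeGroup.mk_toWord⟩
  have : w.norm ≤ n := by
    have h2 : len X w ≤ n := hw
    unfold len at h2
    convert h2
  exact this

theorem spectrum_isGreatest (X : Finset G) (k m n : ℕ) :
    IsGreatest (area (relators X m) ''
      {w | w ∈ Subgroup.normalClosure (relators X k) ∧ len X w ≤ n}) (spectrum X k m n) := by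
  have hfin : (area (relators X m) ''
      {w | w ∈ Subgroup.normalClosure (relators X k) ∧ len X w ≤ n}).Finite :=
    ((finite_len_le X n).subset fun w hw => hw.2).image _
  have hne : (area (relators X m) ''
      {w | w ∈ Subgroup.normalClosure (relators X k) ∧ len X w ≤ n}).Nonempty :=
    ⟨_, 1, ⟨one_mem _, by simp [len]⟩, rfl⟩
  exact ⟨Nat.sSup_mem hne hfin.bddAbove, fun a ha => le_csSup hfin.bddAbove ha⟩

/-- The relation `f ≼ g` between functions of triples `(k,m,n)` of positive integers
with `k ≤ m`: for some positive integer `C`,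
`f(k, Cm, n) ≤ C g(Ck, m, Cn) + C n/m + C` for all `(k,m,n)` with `m ≥ Ck`. -/
def Dominated (f g : ℕ → ℕ → ℕ → ℝ) : Prop :=
  ∃ C : ℕ, 0 < C ∧ ∀ k m n : ℕ, 0 < k → 0 < m → 0 < n → C * k ≤ m →
    f k (C * m) n ≤ C * g (C * k) m (C * n) + C * ((n : ℝ) / (m : ℝ)) + C

/-! ### The word metric -/

theorem eval_surjective {Y : Finset G} (hY : Subgroup.closure (Y : Set G) = ⊤) :
    Function.Surjective (eval Y) := by
  rw [← MonoidHom.range_eq_top, eval, FreeGroup.range_lift_eq_closure, ← hY]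
  congr 1
  ext x
  simp

/-- The word length of `g` with respect to `Y`: the least length of a word over `Y ∪ Y⁻¹`
that represents `g`. -/
def wordLen (Y : Finset G) (g : G) : ℕ :=
  sInf (len Y '' {w | eval Y w = g})

/-- The group `G` regarded as a metric space with the word metric
of the finite generating set `Y`. -/
@[nolint unusedArguments]
def WordSpace (Y : Finset G) (_hY : Subgroup.closure (Y : Set G) = ⊤) : Type _ := G

theorem exists_word {Y : Finset G} (hY : Subgroup.closure (Y : Set G) = ⊤) (g : G) :
    ∃ w, eval Y w = g ∧ len Y w = wordLen Y g := by
  obtain ⟨w, hw⟩ := eval_surjective hY g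
  have h : wordLen Y g ∈ len Y '' {w | eval Y w = g} := Nat.sInf_mem ⟨_, w, hw, rfl⟩
  obtain ⟨v, hv, h⟩ := h
  exact ⟨v, hv, h⟩

theorem wordLen_le {Y : Finset G} (w : FreeGroup Y) : wordLen Y (eval Y w) ≤ len Y w :=
  Nat.sInf_le ⟨w, rfl, rfl⟩

/-- The word metric `d(g, h) = |g⁻¹ h|` on `G`. -/
def wordDist (Y : Finset G) (g h : G) : ℝ := wordLen Y (g⁻¹ * h)

theorem wordDist_self (Y : Finset G) (g : G) : wordDist Y g g = 0 := by
  have h := wordLen_le (Y := Y) 1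
  have h1 : len Y 1 = 0 := by simp [len]
  rw [h1, map_one] at h
  simpa [wordDist] using h

theorem wordDist_comm {Y : Finset G} (hY : Subgroup.closure (Y : Set G) = ⊤) (g h : G) :
    wordDist Y g h = wordDist Y h g := by
  have key : ∀ a : G, wordLen Y a⁻¹ ≤ wordLen Y a := by
    intro a
    obtain ⟨w, hw, hl⟩ := exists_word hY a
    have h2 := wordLen_le w⁻¹
    rw [map_inv, hw] at h2
    have h3 : len Y w⁻¹ = len Y w := by simp [len]
    omega
  have h1 := key (g⁻¹ * h)
  have h2 := key (h⁻¹ * g)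
  rw [mul_inv_rev, inv_inv] at h1 h2
  unfold wordDist
  exact_mod_cast le_antisymm h2 h1

theorem wordDist_triangle {Y : Finset G} (hY : Subgroup.closure (Y : Set G) = ⊤) (a b c : G) :
    wordDist Y a c ≤ wordDist Y a b + wordDist Y b c := by
  classical
  obtain ⟨u, hu, hul⟩ := exists_word hY (a⁻¹ * b)
  obtain ⟨v, hv, hvl⟩ := exists_word hY (b⁻¹ * c)
  have h := wordLen_le (u * v)
  have h2 : len Y (u * v) ≤ len Y u + len Y v := by
    unfold len
    exact FreeGroup.norm_mul_le u v
  have e : eval Y (u * v) = a⁻¹ * c := by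
    rw [map_mul, hu, hv]; group
  rw [e] at h
  have h3 := h.trans h2
  rw [hul, hvl] at h3
  unfold wordDist
  exact_mod_cast h3

theorem eq_of_wordDist_eq_zero {Y : Finset G} (hY : Subgroup.closure (Y : Set G) = ⊤) {a b : G}
    (h : wordDist Y a b = 0) : a = b := by
  classical
  have h' : wordLen Y (a⁻¹ * b) = 0 := by
    unfold wordDist at h
    exact_mod_cast h
  obtain ⟨w, hw, hl⟩ := exists_word hY (a⁻¹ * b)
  rw [h'] at hl
  unfold len at hl
  rw [FreeGroup.norm_eq_zero] at hl
  rw [hl, map_one] at hw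
  exact inv_mul_eq_one.1 hw.symm

instance (Y : Finset G) (hY : Subgroup.closure (Y : Set G) = ⊤) :
    MetricSpace (WordSpace Y hY) where
  dist := wordDist (G := G) Y
  dist_self := wordDist_self (G := G) Y
  dist_comm := wordDist_comm (G := G) hY
  dist_triangle := wordDist_triangle (G := G) hY
  eq_of_dist_eq_zero := eq_of_wordDist_eq_zero (G := G) hY

/-! ### Asymptotic cones -/

/-- The data defining an asymptotic cone of a metric space `M`: an ultrafilter `ω` on an index
set `ι`, positive scaling factors with `ω`-limit `0`, and a family of observation points.
The condition on the scaling factors forces `ω` to be non-principal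
(see `ConeData.ne_pure`). -/
structure ConeData (ι M : Type*) where
  /-- the ultrafilter -/
  ω : Ultrafilter ι
  /-- the scaling factors -/
  scale : ι → ℝ
  scale_pos : ∀ i, 0 < scale i
  tendsto_scale : Tendsto scale ω (𝓝 0)
  /-- the observation points -/
  base : ι → M

theorem ConeData.ne_pure {ι M : Type*} (c : ConeData ι M) (i : ι) : c.ω ≠ pure i := by
  intro h
  have h1 := c.tendsto_scale
  rw [h] at h1
  have h2 : Tendsto c.scale (pure i) (𝓝 (c.scale i)) := tendsto_pure_nhds _ _
  exact (c.scale_pos i).ne' (tendsto_nhds_unique h2 h1)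

variable {ι M : Type*} [MetricSpace M]

/-- Families `(x_i)` of points of `M` whose rescaled distances to the observation points
are bounded `ω`-almost everywhere. -/
structure ConeSeq (c : ConeData ι M) where
  /-- the points -/
  pt : ι → M
  bounded : ∃ B : ℝ, ∀ᶠ i in (c.ω : Filter ι), c.scale i * dist (pt i) (c.base i) ≤ B

/-- The limit along `ω` of the rescaled distances exists. -/
theorem ConeSeq.tendsto_dist {c : ConeData ι M} (x y : ConeSeq c) :
    Tendsto (fun i => c.scale i * dist (x.pt i) (y.pt i)) c.ω
      (𝓝 (limUnder (c.ω : Filter ι) fun i => c.scale i * dist (x.pt i) (y.pt i))) := by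
  obtain ⟨A, hA⟩ := x.bounded
  obtain ⟨B, hB⟩ := y.bounded
  have hmem : ∀ᶠ i in (c.ω : Filter ι),
      c.scale i * dist (x.pt i) (y.pt i) ∈ Set.Icc 0 (A + B) := by
    filter_upwards [hA, hB] with i ha hb
    have hs := (c.scale_pos i).le
    refine ⟨mul_nonneg hs dist_nonneg, ?_⟩
    calc c.scale i * dist (x.pt i) (y.pt i)
        ≤ c.scale i * (dist (x.pt i) (c.base i) + dist (y.pt i) (c.base i)) :=
          mul_le_mul_of_nonneg_left (dist_triangle_right _ _ _) hs
      _ ≤ A + B := by rw [mul_add]; exact add_le_add ha hb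
  obtain ⟨a, -, ha⟩ := (isCompact_Icc (a := (0 : ℝ)) (b := A + B)).ultrafilter_le_nhds
    (c.ω.map fun i => c.scale i * dist (x.pt i) (y.pt i))
    (le_principal_iff.2 hmem)
  exact tendsto_nhds_limUnder ⟨a, ha⟩

/-- The pseudometric `d((x_i), (y_i)) = lim_ω scale_i * d(x_i, y_i)`. -/
instance (c : ConeData ι M) : PseudoMetricSpace (ConeSeq c) where
  dist x y := limUnder (c.ω : Filter ι) fun i => c.scale i * dist (x.pt i) (y.pt i)
  dist_self x := by
    simp only [dist_self, mul_zero]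
    exact tendsto_const_nhds.limUnder_eq
  dist_comm x y := by simp only [dist_comm]
  dist_triangle x y z := by
    refine le_of_tendsto_of_tendsto' (x.tendsto_dist z)
      ((x.tendsto_dist y).add (y.tendsto_dist z)) fun i => ?_
    rw [← mul_add]
    exact mul_le_mul_of_nonneg_left (dist_triangle _ _ _) (c.scale_pos i).le

/-- The asymptotic cone of `M` given by the data `c`, that is, the ultralimit of the pointed metric
spaces `(M, scale_i * d, base_i)`: bounded families modulo the relation of being
at distance `0`, with the induced metric. -/
abbrev AsymptoticCone (c : ConeData ι M) : Type _ := SeparationQuotient (ConeSeq c)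

end IsoSpectrum

end

/-!
# Simply connected asymptotic cones from the isoperimetric spectrum

Write `T` for the cone. Since `G` is finitely presented, all relations follow from the relations of
some bounded length, so the hypothesis on the spectrum says: relations of length at most `b / t` are
products of at most `N` conjugates of relations of length at most `a / t`, where `N` depends on
`a` and `b` but not on the small number `t` (`exists_isProdOfConj_of_dominated`).

The conjugating words in such a product may be arbitrarily long, which is the main difficulty in
passing to the limit. Van Kampen diagrams are avoided as follows. Let `V` consist of finitely many
sample points on a loop in the Cayley graph and of the base points of the `N` relations. Move the
vertices of edges near `V` to points of `V`, and forget all other edges. This turns words into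
elements of any group labelled by the edges of the graph on `V` at scale ten times the length of
the relations, as long as the labelling is multiplicative on triangles. The `N` relations become
trivial, hence so does the sampled loop (`exists_coarse_filling`). In other words, the sampled loop
is null-homotopic in the clique complex of a finite graph with a bounded number of vertices, and
only the component of the loop matters. Along the ultrafilter these finite graphs are constant, so
the picture survives in `T`: a quadrangle of size `ε` in `T` is sampled by a loop in a finite
clique complex mapped to `T`, of bounded size compared to `ε`, with edges shorter than `ε / 80`.
A null-homotopy in the geometric realization, followed by passing from a point to the vertex with
the largest barycentric coordinate, is a map from the square to `T` with small jumps
(`exists_fillsQuadrangles`).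

Finally, a map from the square to `T` with jumps at most `δ` can be restricted to a fine grid and
refilled cell by cell. This halves the jumps, moves points by `O(δ)` and keeps the boundary
values (`exists_refinement`). The limit of iterated refinements, which exists since `T` is complete,
is a continuous extension of the boundary values, so paths with common ends are homotopic
(`simplyConnectedSpace_of_fillsQuadrangles`). The paths `conePath` show that `T` is path connected.
-/

open Filter Topology

noncomputable section

namespace IsoSpectrum

open scoped unitInterval

/-! ### Words and word metrics -/

section

section Words

variable {G : Type*}

theorem len_mul_le (X : Finset G) (u v : FreeGroup X) : len X (u * v) ≤ len X u + len X v := by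
  classical
  unfold len
  exact FreeGroup.norm_mul_le u v

theorem len_inv (X : Finset G) (u : FreeGroup X) : len X u⁻¹ = len X u := by
  simp [len]

theorem len_mk_le (X : Finset G) (L : List (X × Bool)) : len X (FreeGroup.mk L) ≤ L.length := by
  classical
  unfold len
  exact FreeGroup.norm_mk_le

/-- The element of the free group represented by the first `m` letters of the reduced word
of `u`. -/
def wordPrefix {X : Finset G} (u : FreeGroup X) (m : ℕ) : FreeGroup X :=
  open Classical in FreeGroup.mk (u.toWord.take m)

theorem wordPrefix_zero {X : Finset G} (u : FreeGroup X) : wordPrefix u 0 = 1 := by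
  simp [wordPrefix, FreeGroup.one_eq_mk]

theorem wordPrefix_len {X : Finset G} (u : FreeGroup X) : wordPrefix u (len X u) = u := by
  classical
  have : len X u = u.toWord.length := rfl
  unfold wordPrefix
  convert FreeGroup.mk_toWord (x := u) using 2
  rw [List.take_of_length_le]
  rw [this]

theorem len_wordPrefix_step {X : Finset G} (u : FreeGroup X) {m n : ℕ} (h : m ≤ n) :
    len X ((wordPrefix u m)⁻¹ * wordPrefix u n) ≤ n - m := by
  classical
  have e : wordPrefix u n = wordPrefix u m * FreeGroup.mk ((u.toWord.drop m).take (n - m)) := by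
    unfold wordPrefix
    rw [FreeGroup.mul_mk]
    congr 1
    conv_lhs => rw [← Nat.add_sub_cancel' h, List.take_add]
  rw [e, inv_mul_cancel_left]
  exact (len_mk_le X _).trans (by simp)

/-- A nonempty reduced word is a shorter word followed by one letter. -/
theorem exists_letter_of_len {X : Finset G} {n : ℕ} (w : FreeGroup X) (hw : len X w = n + 1) :
    ∃ (v : FreeGroup X) (x : X), len X v = n ∧
      (w = v * FreeGroup.of x ∨ w = v * (FreeGroup.of x)⁻¹) := by
  classical
  have hl : w.toWord.length = n + 1 := hw
  have hne : w.toWord ≠ [] := by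
    intro h; rw [h] at hl; simp at hl
  obtain ⟨L, ⟨x, b⟩, hL⟩ := (List.eq_nil_or_concat' w.toWord).resolve_left hne
  have hlen : L.length = n := by
    rw [hL] at hl; simpa using hl
  have hw' : w = FreeGroup.mk L * FreeGroup.mk [(x, b)] := by
    rw [FreeGroup.mul_mk, ← hL, FreeGroup.mk_toWord]
  refine ⟨FreeGroup.mk L, x, ?_, ?_⟩
  · apply le_antisymm
    · rw [← hlen]; exact len_mk_le X L
    · have h1 := len_mul_le X (FreeGroup.mk L) (FreeGroup.mk [(x, b)])
      have h2 := len_mk_le X [(x, b)]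
      rw [← hw', hw] at h1
      simp at h2
      omega
  · cases b
    · right; rw [hw']; simp [FreeGroup.of, FreeGroup.inv_mk, FreeGroup.invRev]
    · left; rw [hw']; rfl

end Words

variable {G : Type*} [Group G]

theorem wordDist_nonneg (Y : Finset G) (g h : G) : 0 ≤ wordDist Y g h := by
  unfold wordDist; positivity

theorem wordDist_mul_eval_le (X : Finset G) (g : G) (w : FreeGroup X) :
    wordDist X g (g * eval X w) ≤ len X w := by
  unfold wordDist
  rw [inv_mul_cancel_left]
  exact_mod_cast wordLen_le w

theorem wordDist_mul_eval_mul_eval_le (X : Finset G) (g : G) (v w : FreeGroup X) :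
    wordDist X (g * eval X v) (g * eval X w) ≤ len X (v⁻¹ * w) := by
  have h := wordDist_mul_eval_le X (g * eval X v) (v⁻¹ * w)
  rwa [map_mul, map_inv, mul_assoc, mul_inv_cancel_left] at h

/-- Word metrics of two finite generating sets are Lipschitz equivalent. -/
theorem exists_wordDist_le (X : Finset G) (hX : Subgroup.closure (X : Set G) = ⊤) (Y : Finset G)
    (hY : Subgroup.closure (Y : Set G) = ⊤) :
    ∃ K : ℝ, 1 ≤ K ∧ ∀ g h : G, wordDist Y g h ≤ K * wordDist X g h := by
  obtain ⟨K, hK⟩ : ∃ K : ℕ, ∀ x ∈ X, wordLen Y x ≤ K :=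
    ⟨X.sup (wordLen Y), fun x hx => Finset.le_sup hx⟩
  have key : ∀ n : ℕ, ∀ w : FreeGroup X, len X w = n → ∀ g, wordDist Y g (g * eval X w) ≤ K * n := by
    intro n
    induction n with
    | zero =>
      intro w hw g
      classical
      have : w = 1 := by
        unfold len at hw
        exact FreeGroup.norm_eq_zero.1 hw
      subst this
      simp [wordDist_self]
    | succ n ih =>
      intro w hw g
      obtain ⟨v, x, hv, hx⟩ := exists_letter_of_len w hw
      have h1 := ih v hv g
      have h2 : ∀ a, wordDist Y a (a * (x : G)) ≤ K := by
        intro a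
        unfold wordDist
        rw [inv_mul_cancel_left]
        exact_mod_cast hK x x.2
      have h3 := wordDist_triangle hY g (g * eval X v) (g * eval X w)
      have h4 : wordDist Y (g * eval X v) (g * eval X w) ≤ K := by
        rcases hx with h | h
        · rw [h, map_mul, ← mul_assoc]
          convert h2 _
          simp [eval]
        · rw [h, map_mul, ← mul_assoc, wordDist_comm hY]
          have := h2 (g * eval X v * eval X (FreeGroup.of x)⁻¹)
          convert this using 2
          simp [eval]
      push_cast
      linarith
  refine ⟨max (K : ℝ) 1, le_max_right _ _, fun g h => ?_⟩
  obtain ⟨w, hw, hl⟩ := exists_word hX (g⁻¹ * h)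
  have h1 := key _ w rfl g
  rw [hw, mul_inv_cancel_left, hl] at h1
  calc wordDist Y g h ≤ K * wordDist X g h := h1
    _ ≤ max (K : ℝ) 1 * wordDist X g h :=
      mul_le_mul_of_nonneg_right (le_max_left _ _) (wordDist_nonneg _ _ _)

/-! ### Finite presentability and the number of short relators -/

/-- Finite presentability does not depend on the finite generating set: all relators over `X`
follow from those of bounded length. -/
theorem exists_ker_le_normalClosure_relators (hG : Group.IsFinitelyPresented G) (X : Finset G)
    (hX : Subgroup.closure (X : Set G) = ⊤) :
    ∃ k : ℕ, 0 < k ∧ (eval X).ker ≤ Subgroup.normalClosure (relators X k) := by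
  obtain ⟨n, φ, hφ, R, hR, hRφ⟩ := hG.out
  -- A Tietze transformation: both sets of generators are expressed by each other.
  choose a ha using fun i : Fin n => eval_surjective hX (φ (FreeGroup.of i))
  choose b hb using fun x : X => hφ (x : G)
  set α : FreeGroup (Fin n) →* FreeGroup X := FreeGroup.lift a with hα
  set β : FreeGroup X →* FreeGroup (Fin n) := FreeGroup.lift b with hβ
  have hαe : (eval X).comp α = φ := by
    ext i; simp [hα, ha]
  have hβe : φ.comp β = eval X := by
    ext x; simp [hβ, hb, eval]
  set S : Set (FreeGroup X) :=
    α '' R ∪ Set.range fun x : X => (FreeGroup.of x)⁻¹ * α (β (FreeGroup.of x)) with hS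
  have hSfin : S.Finite := (hR.image _).union (Set.finite_range _)
  obtain ⟨k, hk⟩ : ∃ k : ℕ, ∀ s ∈ S, len X s ≤ k :=
    ⟨hSfin.toFinset.sup (len X), fun s hs => Finset.le_sup (by simpa using hs)⟩
  have hSe : ∀ s ∈ S, eval X s = 1 := by
    rintro s (⟨r, hr, rfl⟩ | ⟨x, rfl⟩)
    · have : r ∈ φ.ker := hRφ ▸ Subgroup.subset_normalClosure hr
      rw [← MonoidHom.comp_apply, hαe]
      exact this
    · have h1 : eval X (α (β (FreeGroup.of x))) = eval X (FreeGroup.of x) := by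
        rw [← MonoidHom.comp_apply, hαe, ← MonoidHom.comp_apply, hβe]
      simp [h1]
  have hker : (eval X).ker ≤ Subgroup.normalClosure S := by
    intro w hw
    have hq : (QuotientGroup.mk' (Subgroup.normalClosure S)).comp (α.comp β) =
        QuotientGroup.mk' (Subgroup.normalClosure S) := by
      ext x
      simp only [MonoidHom.comp_apply, QuotientGroup.mk'_apply]
      refine (QuotientGroup.eq.2 ?_).symm
      exact Subgroup.subset_normalClosure (Or.inr ⟨x, rfl⟩)
    have h1 : α (β w) ∈ Subgroup.normalClosure S := by
      have h2 : β w ∈ φ.ker := by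
        rw [MonoidHom.mem_ker, ← MonoidHom.comp_apply, hβe]; exact hw
      rw [← hRφ] at h2
      have h3 : Subgroup.normalClosure R ≤ (Subgroup.normalClosure S).comap α :=
        Subgroup.normalClosure_le_normal fun r hr =>
          Subgroup.subset_normalClosure (Or.inl ⟨r, hr, rfl⟩)
      exact h3 h2
    have h2 := DFunLike.congr_fun hq w
    simp only [MonoidHom.comp_apply, QuotientGroup.mk'_apply] at h2
    rw [(QuotientGroup.eq_one_iff _).2 h1] at h2
    exact (QuotientGroup.eq_one_iff _).1 h2.symm
  refine ⟨k + 1, by omega, hker.trans (Subgroup.normalClosure_mono fun s hs => ⟨hSe s hs, ?_⟩)⟩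
  exact (hk s hs).trans (by omega)

/-- The hypothesis on the spectrum in the form in which it is used: for fixed `a, b > 0` and
all small `t > 0`, every relation of length at most `b / t` is a product of a bounded number
of conjugates of relations of length at most `a / t`. -/
theorem exists_isProdOfConj_of_dominated (hG : Group.IsFinitelyPresented G)
    (X : Finset G) (hX : Subgroup.closure (X : Set G) = ⊤)
    (g : ℚ → ℝ) (hg : MonotoneOn g (Set.Ioi 0))
    (hfg : Dominated (fun k m n => (spectrum X k m n : ℝ)) (fun _ m n => g ((n : ℚ) / (m : ℚ))))
    {a b : ℝ} (ha : 0 < a) (hb : 0 < b) :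
    ∃ N : ℕ, ∃ t₀ : ℝ, 0 < t₀ ∧ ∀ t : ℝ, 0 < t → t ≤ t₀ → ∀ w : FreeGroup X, eval X w = 1 →
      (len X w : ℝ) ≤ b / t →
      ∃ l ≤ N, IsProdOfConj {R | eval X R = 1 ∧ (len X R : ℝ) ≤ a / t} w l := by
  obtain ⟨k, hk0, hk⟩ := exists_ker_le_normalClosure_relators hG X hX
  obtain ⟨C, hC, hfg⟩ := hfg
  have hC' : (0 : ℝ) < C := by exact_mod_cast hC
  obtain ⟨q, hq⟩ := exists_rat_gt (4 * C * (C * b / a) : ℝ)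
  obtain ⟨N, hN⟩ := exists_nat_ge (C * g q + 4 * C * (C * b / a) + C : ℝ)
  refine ⟨N, min b (a / (2 * C * (C * k + 1))), by positivity, ?_⟩
  intro t ht htle w hw hlen
  have htb : t ≤ b := htle.trans (min_le_left _ _)
  have hta : t ≤ a / (2 * C * (C * k + 1)) := htle.trans (min_le_right _ _)
  -- With this choice `C * m ≤ a / t`, while `n / m` is bounded independently of `t`.
  set n := ⌈b / t⌉₊ with hn
  set m := ⌊a / (C * t)⌋₊ with hm
  have hn0 : 0 < n := Nat.ceil_pos.2 (by positivity)
  have hnle : (n : ℝ) ≤ 2 * (b / t) := by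
    have h1 : (n : ℝ) < b / t + 1 := Nat.ceil_lt_add_one (by positivity)
    have h2 : 1 ≤ b / t := (one_le_div ht).2 htb
    linarith
  have hbig : 2 * (C * k + 1) ≤ a / (C * t) := by
    rw [le_div_iff₀ (by positivity)] at hta ⊢
    linarith
  have hm1 : a / (C * t) < m + 1 := Nat.lt_floor_add_one _
  have hCk : (0 : ℝ) ≤ C * k := by positivity
  have hmge : a / (C * t) / 2 ≤ m := by linarith
  have hm0 : 0 < m := by
    have : (0 : ℝ) < m := by linarith
    exact_mod_cast this
  have hm0' : (0 : ℝ) < m := by exact_mod_cast hm0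
  have hCkm : C * k ≤ m := by
    have : ((C * k : ℕ) : ℝ) ≤ m := by push_cast; linarith
    exact_mod_cast this
  have hratio : (n : ℝ) / m ≤ 4 * (C * b / a) := by
    rw [div_le_iff₀ hm0']
    calc (n : ℝ) ≤ 2 * (b / t) := hnle
      _ = 4 * (C * b / a) * (a / (C * t) / 2) := by field_simp; norm_num
      _ ≤ _ := by gcongr
  have hspec := hfg k m n hk0 hm0 hn0 hCkm
  simp only at hspec
  have hg' : g (((C * n : ℕ) : ℚ) / (m : ℚ)) ≤ g q := by
    have h0 : (0 : ℚ) < ((C * n : ℕ) : ℚ) / (m : ℚ) := by positivity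
    have hle : ((C * n : ℕ) : ℚ) / (m : ℚ) ≤ q := by
      have : ((((C * n : ℕ) : ℚ) / (m : ℚ) : ℚ) : ℝ) ≤ q := by
        push_cast
        calc (C * n / m : ℝ) = C * (n / m) := by ring
          _ ≤ C * (4 * (C * b / a)) := by gcongr
          _ = 4 * C * (C * b / a) := by ring
          _ ≤ q := hq.le
      exact_mod_cast this
    exact hg (Set.mem_Ioi.2 h0) (Set.mem_Ioi.2 (h0.trans_le hle)) hle
  have hspecN : spectrum X k (C * m) n ≤ N := by
    have : (spectrum X k (C * m) n : ℝ) ≤ N := by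
      refine hspec.trans (le_trans ?_ hN)
      have h1 := mul_le_mul_of_nonneg_left hg' hC'.le
      have h2 := mul_le_mul_of_nonneg_left hratio hC'.le
      linarith
    exact_mod_cast this
  have hwk : w ∈ Subgroup.normalClosure (relators X k) := hk hw
  have hwn : len X w ≤ n := by
    have : (len X w : ℝ) ≤ n := hlen.trans (Nat.le_ceil _)
    exact_mod_cast this
  have harea : area (relators X (C * m)) w ≤ N :=
    ((spectrum_isGreatest X k (C * m) n).2 ⟨w, ⟨hwk, hwn⟩, rfl⟩).trans hspecN
  have hmono : relators X k ⊆ relators X (C * m) := fun R hR =>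
    ⟨hR.1, hR.2.trans (by nlinarith)⟩
  have hmem : IsProdOfConj (relators X (C * m)) w (area (relators X (C * m)) w) :=
    Nat.sInf_mem (s := {l | IsProdOfConj (relators X (C * m)) w l})
      (exists_isProdOfConj (Subgroup.normalClosure_mono hmono hwk))
  refine ⟨_, harea, ?_⟩
  obtain ⟨L, hLl, hL, hLw⟩ := hmem
  refine ⟨L, hLl, fun c hc => ?_, hLw⟩
  obtain ⟨f, R, hR, hcR⟩ := hL c hc
  refine ⟨f, R, ⟨hR.1, ?_⟩, hcR⟩
  have h1 : (len X R : ℝ) ≤ ((C * m : ℕ) : ℝ) := by exact_mod_cast hR.2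
  refine h1.trans ?_
  have h2 : (m : ℝ) ≤ a / (C * t) := Nat.floor_le (by positivity)
  push_cast
  calc (C * m : ℝ) ≤ C * (a / (C * t)) := by gcongr
    _ = a / t := by field_simp

end

/-! ### Holonomy along words and coarse null-homotopies -/

section

variable {G : Type*} [Group G]

/-- A labelling `φ` of the edges `(g, g * x)` of the Cayley graph by elements of a group `Q`
extends to a holonomy `Φ g w` along the path which starts at `g` and reads the word `w`. It only
depends on `w` as an element of the free group. -/
theorem exists_holonomy {Q : Type*} [Group Q] (X : Finset G) (φ : G → X → Q) :
    ∃ Φ : G → FreeGroup X → Q, (∀ g x, Φ g (FreeGroup.of x) = φ g x) ∧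
      ∀ g v w, Φ g (v * w) = Φ g v * Φ (g * eval X v) w := by
  -- The holonomy is read off from a right action of the free group on `G × Q`.
  let act : X → Equiv.Perm (G × Q) := fun x =>
    { toFun := fun p => (p.1 * x, p.2 * φ p.1 x)
      invFun := fun p => (p.1 * (x : G)⁻¹, p.2 * (φ (p.1 * (x : G)⁻¹) x)⁻¹)
      left_inv := fun p => by simp
      right_inv := fun p => by simp }
  let Ψ : FreeGroup X →* (Equiv.Perm (G × Q))ᵐᵒᵖ := FreeGroup.lift fun x => MulOpposite.op (act x)
  have hmul : ∀ v w p, (Ψ (v * w)).unop p = (Ψ w).unop ((Ψ v).unop p) := by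
    intro v w p
    rw [map_mul, MulOpposite.unop_mul, Equiv.Perm.mul_apply]
  have hof : ∀ x p, (Ψ (FreeGroup.of x)).unop p = (p.1 * x, p.2 * φ p.1 x) := by
    intro x p
    simp [Ψ, act]
  have hinv : ∀ x p, (Ψ (FreeGroup.of x)⁻¹).unop p =
      (p.1 * (x : G)⁻¹, p.2 * (φ (p.1 * (x : G)⁻¹) x)⁻¹) := by
    intro x p
    simp only [Ψ, map_inv, FreeGroup.lift_apply_of, MulOpposite.unop_inv, MulOpposite.unop_op]
    rfl
  have hequi : ∀ w g a, (Ψ w).unop (g, a) = (g * eval X w, a * ((Ψ w).unop (g, 1)).2) := by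
    intro w
    induction w using FreeGroup.induction_on with
    | C1 => intro g a; simp
    | of x => intro g a; simp [hof, eval]
    | inv_of x _ =>
      intro g a
      rw [hinv, hinv, one_mul]
      simp [eval]
    | mul v w hv hw =>
      intro g a
      rw [hmul, hmul, hv g a, hw, hv g 1, one_mul, hw _ ((Ψ v).unop (g, 1)).2, map_mul, mul_assoc,
        mul_assoc]
  refine ⟨fun g w => ((Ψ w).unop (g, 1)).2, fun g x => by simp [hof], fun g v w => ?_⟩
  simp only
  rw [hmul, hequi v g 1, one_mul, hequi w]

/-- The coarse holonomy. Let `V` be a finite family of points of `G`, and let `e` be a labelling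
of pairs of members that is multiplicative on triples of diameter at most `10 r`. Moving the
vertices of an edge near `V` to members of `V`, and ignoring the other edges, one obtains a
holonomy on words which is trivial on relations of length at most `r` read at a member of `V` or
far from all of them, and which agrees with `e`, up to a change of gauge `ψ`, on short words
connecting members of `V`. -/
theorem exists_coarse_holonomy {Q : Type*} [Group Q] (X : Finset G)
    (hX : Subgroup.closure (X : Set G) = ⊤) {J : Type*} [Nonempty J] (V : J → G) {r : ℝ}
    (hr : 1 ≤ r) (e : J → J → Q)
    (he : ∀ u v z, wordDist X (V u) (V v) ≤ 10 * r → wordDist X (V v) (V z) ≤ 10 * r →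
      wordDist X (V u) (V z) ≤ 10 * r → e u v * e v z = e u z) :
    ∃ Φ : G → FreeGroup X → Q, (∀ g v w, Φ g (v * w) = Φ g v * Φ (g * eval X v) w) ∧
      (∀ R, eval X R = 1 → (len X R : ℝ) ≤ r → ∀ g,
        ((∃ u, V u = g) ∨ ∀ u, 10 * r < wordDist X g (V u)) → Φ g R = 1) ∧
      ∃ ψ : J → Q, ∀ u v w, (len X w : ℝ) ≤ r → V u * eval X w = V v →
        Φ (V u) w = (ψ u)⁻¹ * e u v * ψ v := by
  classical
  -- The points near `V`, and a coarse projection of these to `V`.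
  let near : G → Prop := fun h => ∃ u, wordDist X h (V u) ≤ 2 * r
  let pr : G → J := fun h => if hh : near h then hh.choose else Classical.arbitrary J
  have hpr : ∀ h, near h → wordDist X h (V (pr h)) ≤ 2 * r := by
    intro h hh
    simp only [pr, dif_pos hh]
    exact hh.choose_spec
  obtain ⟨Φ, hΦ1, hΦ⟩ := exists_holonomy X fun (g : G) (x : X) =>
    if near g ∧ near (g * x) then e (pr g) (pr (g * x)) else 1
  have hΦone : ∀ g, Φ g 1 = 1 := by
    intro g
    have h := hΦ g 1 1
    simpa using h
  have hΦinv : ∀ g x, Φ g (FreeGroup.of x)⁻¹ = (Φ (g * (x : G)⁻¹) (FreeGroup.of x))⁻¹ := by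
    intro g x
    have h := hΦ g (FreeGroup.of x)⁻¹ (FreeGroup.of x)
    rw [inv_mul_cancel, hΦone] at h
    rw [eq_inv_iff_mul_eq_one, h]
    simp [eval]
  have tri := wordDist_triangle hX
  have comm := wordDist_comm hX
  have clo : ∀ h h' D, near h → near h' → wordDist X h h' ≤ D →
      wordDist X (V (pr h)) (V (pr h')) ≤ D + 4 * r := by
    intro h h' D hn hn' hd
    have h1 := hpr h hn
    have h2 := hpr h' hn'
    have h3 := tri (V (pr h)) h (V (pr h'))
    have h4 := tri h h' (V (pr h'))
    rw [comm (V (pr h)) h] at h3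
    linarith
  have eself : ∀ u, e u u = 1 := by
    intro u
    have h0 : wordDist X (V u) (V u) ≤ 10 * r := by rw [wordDist_self]; linarith
    exact mul_eq_left.1 (he u u u h0 h0 h0)
  have letter : ∀ h (x : X), wordDist X h (h * (x : G)) ≤ 1 := by
    intro h x
    have h1 := wordDist_mul_eval_le X h (FreeGroup.of x)
    have h2 : len X (FreeGroup.of x) ≤ 1 := len_mk_le X _
    have h3 : (len X (FreeGroup.of x) : ℝ) ≤ 1 := by exact_mod_cast h2
    simp only [eval, FreeGroup.lift_apply_of] at h1
    linarith
  have step : ∀ h h', near h → near h' → wordDist X h h' ≤ 1 →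
      e (pr h) (pr h') * e (pr h') (pr h) = 1 := by
    intro h h' hn hn' hd
    rw [he, eself]
    · linarith [clo h h' 1 hn hn' hd]
    · linarith [clo h' h 1 hn' hn (by rw [comm]; exact hd)]
    · rw [wordDist_self]; linarith
  -- Words of length at most `r` read at a member of `V` stay near `V`.
  have key : ∀ n : ℕ, (n : ℝ) ≤ r → ∀ u w, len X w = n →
      Φ (V u) w = e (pr (V u)) (pr (V u * eval X w)) := by
    intro n
    induction n with
    | zero =>
      intro _ u w hw
      have : w = 1 := by
        unfold len at hw
        exact FreeGroup.norm_eq_zero.1 hw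
      subst this
      rw [hΦone, map_one, mul_one, eself]
    | succ n ih =>
      intro hn u w hw
      obtain ⟨v, x, hv, hx⟩ := exists_letter_of_len w hw
      have hn' : (n : ℝ) ≤ r := by push_cast at hn; linarith
      have hnear : ∀ z, (len X z : ℝ) ≤ r → near (V u * eval X z) := by
        intro z hz
        refine ⟨u, ?_⟩
        rw [comm]
        linarith [wordDist_mul_eval_le X (V u) z]
      have hu : near (V u) := ⟨u, by rw [wordDist_self]; linarith⟩
      have hnv := hnear v (by rw [hv]; exact hn')
      have hnw := hnear w (by rw [hw]; exact hn)
      have hdv := wordDist_mul_eval_le X (V u) v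
      have hdw := wordDist_mul_eval_le X (V u) w
      rw [hv] at hdv
      rw [hw] at hdw
      have hd : wordDist X (V u * eval X v) (V u * eval X w) ≤ 1 := by
        rcases hx with h | h
        · rw [h, map_mul, ← mul_assoc]
          simpa [eval] using letter (V u * eval X v) x
        · rw [h, map_mul, ← mul_assoc, comm]
          simpa [eval] using letter (V u * eval X v * (x : G)⁻¹) x
      have hlast : ∃ s, Φ (V u) w = Φ (V u) v * s ∧
          s = e (pr (V u * eval X v)) (pr (V u * eval X w)) := by
        rcases hx with h | h
        · refine ⟨Φ (V u * eval X v) (FreeGroup.of x), by rw [h, hΦ], ?_⟩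
          have e1 : V u * eval X v * (x : G) = V u * eval X w := by
            rw [h, map_mul, ← mul_assoc]; simp [eval]
          rw [hΦ1, e1, if_pos ⟨hnv, hnw⟩]
        · refine ⟨Φ (V u * eval X v) (FreeGroup.of x)⁻¹, by rw [h, hΦ], ?_⟩
          have e1 : V u * eval X v * (x : G)⁻¹ = V u * eval X w := by
            rw [h, map_mul, ← mul_assoc]; simp [eval]
          rw [hΦinv, hΦ1, e1]
          have e2 : V u * eval X w * (x : G) = V u * eval X v := by
            rw [← e1]; group
          rw [e2, if_pos ⟨hnw, hnv⟩, inv_eq_iff_mul_eq_one]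
          exact step _ _ hnw hnv (by rw [comm]; exact hd)
      obtain ⟨s, hs, hs'⟩ := hlast
      rw [hs, hs', ih hn' u v hv, he]
      · linarith [clo _ _ _ hu hnv hdv]
      · linarith [clo _ _ _ hnv hnw hd]
      · linarith [clo _ _ _ hu hnw hdw]
  -- Words of length at most `r` read far from `V` only meet edges labelled by `1`.
  have far : ∀ n : ℕ, (n : ℝ) ≤ r → ∀ g, (∀ u, 10 * r < wordDist X g (V u)) →
      ∀ w, len X w = n → Φ g w = 1 := by
    intro n
    induction n with
    | zero =>
      intro _ g _ w hw
      have : w = 1 := by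
        unfold len at hw
        exact FreeGroup.norm_eq_zero.1 hw
      rw [this, hΦone]
    | succ n ih =>
      intro hn g hg w hw
      obtain ⟨v, x, hv, hx⟩ := exists_letter_of_len w hw
      have hn' : (n : ℝ) ≤ r := by push_cast at hn; linarith
      have hnv : ¬ near (g * eval X v) := by
        rintro ⟨u, hu⟩
        have h1 := tri g (g * eval X v) (V u)
        have h2 := wordDist_mul_eval_le X g v
        rw [hv] at h2
        linarith [hg u]
      rcases hx with h | h
      · rw [h, hΦ, ih hn' g hg v hv, hΦ1, if_neg (fun hh => hnv hh.1), one_mul]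
      · rw [h, hΦ, ih hn' g hg v hv, hΦinv, hΦ1, if_neg, inv_one, one_mul]
        rintro ⟨_, hh⟩
        rw [inv_mul_cancel_right] at hh
        exact hnv hh
  refine ⟨Φ, hΦ, ?_, fun u => e u (pr (V u)), ?_⟩
  · rintro R hR hl g (⟨u, rfl⟩ | hg)
    · rw [key _ hl u R rfl, hR, mul_one, eself]
    · exact far _ hl g hg R rfl
  · intro u v w hl hw
    rw [key _ hl u w rfl, hw, mul_assoc, eq_inv_mul_iff_mul_eq]
    have hu : near (V u) := ⟨u, by rw [wordDist_self]; linarith⟩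
    have hv : near (V v) := ⟨v, by rw [wordDist_self]; linarith⟩
    have hd := wordDist_mul_eval_le X (V u) w
    rw [hw] at hd
    have huv : wordDist X (V u) (V v) ≤ r := hd.trans hl
    have h1 := hpr _ hu
    have h2 := hpr _ hv
    have h3 := clo _ _ _ hu hv huv
    have h4 := tri (V u) (V v) (V (pr (V v)))
    rw [he, he]
    · linarith
    · linarith
    · linarith
    · linarith
    · linarith
    · linarith

/-- The holonomy along a chain of members of `V` is the product of the labels. -/
theorem holonomy_chain {Q : Type*} [Group Q] {X : Finset G} {J : Type*} {V : J → G} {r : ℝ}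
    {e : J → J → Q} {Φ : G → FreeGroup X → Q} {ψ : J → Q}
    (hΦ : ∀ g v w, Φ g (v * w) = Φ g v * Φ (g * eval X v) w)
    (hψ : ∀ u v w, (len X w : ℝ) ≤ r → V u * eval X w = V v →
      Φ (V u) w = (ψ u)⁻¹ * e u v * ψ v)
    (g : G) (q : ℕ → FreeGroup X) (c : ℕ → J) (hc : ∀ j, V (c j) = g * eval X (q j))
    (hq : ∀ j, (len X ((q j)⁻¹ * q (j + 1)) : ℝ) ≤ r) (k : ℕ) :
    Φ g (q k) = Φ g (q 0) * (ψ (c 0))⁻¹ *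
      ((List.range k).map fun j => e (c j) (c (j + 1))).prod * ψ (c k) := by
  induction k with
  | zero => simp
  | succ k ih =>
    have h1 : q (k + 1) = q k * ((q k)⁻¹ * q (k + 1)) := by group
    rw [h1, hΦ, ih, ← hc, hψ (c k) (c (k + 1)) _ (hq k), List.range_succ]
    · simp only [List.map_append, List.map_cons, List.map_nil, List.prod_append, List.prod_cons,
        List.prod_nil, mul_one]
      group
    · rw [hc, hc, map_mul, map_inv]; group

/-- Points joined by a chain of steps of size at most `ρ` in a finite pseudometric space are joined
by such a chain without repetitions. -/
theorem dist_le_of_reflTransGen {J : Type*} [Fintype J] {d : J → J → ℝ} (hd0 : ∀ u, d u u = 0)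
    (hsymm : ∀ u v, d u v = d v u) (htri : ∀ u v z, d u z ≤ d u v + d v z) {ρ : ℝ} (hρ : 0 ≤ ρ)
    {u v : J} (h : Relation.ReflTransGen (fun u v => d u v ≤ ρ) u v) :
    d u v ≤ Fintype.card J * ρ := by
  classical
  let Γ : SimpleGraph J :=
    { Adj := fun u v => u ≠ v ∧ d u v ≤ ρ
      symm := ⟨fun u v h => ⟨h.1.symm, by rw [hsymm]; exact h.2⟩⟩
      loopless := ⟨fun u h => h.1 rfl⟩ }
  have hreach : Γ.Reachable u v := by
    induction h with
    | refl => exact SimpleGraph.Reachable.refl _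
    | @tail b c _ hbc ih =>
      by_cases hbc' : b = c
      · rw [← hbc']; exact ih
      · exact ih.trans (SimpleGraph.Adj.reachable ⟨hbc', hbc⟩)
  obtain ⟨p, hp⟩ := hreach.exists_isPath
  have hlen : ∀ {u v : J} (p : Γ.Walk u v), d u v ≤ p.length * ρ := by
    intro u v p
    induction p with
    | nil => simp [hd0]
    | cons h p ih =>
      have h1 := h.2
      simp only [SimpleGraph.Walk.length_cons]
      push_cast
      exact (htri _ _ _).trans (by linarith)
  refine (hlen p).trans (mul_le_mul_of_nonneg_right ?_ hρ)
  exact_mod_cast hp.length_lt.le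

/-- The index set of the points used to fill a four-sided loop: the points of a `k × k` grid
(of which only the boundary matters) and `N` further points. -/
abbrev FillIndex (k N : ℕ) : Type := (Fin (k + 1) × Fin (k + 1)) ⊕ Fin N

/-- The grid point with the given coordinates, which are cut off at `k`. -/
def gridIndex (k N i j : ℕ) : FillIndex k N :=
  Sum.inl (⟨min i k, by omega⟩, ⟨min j k, by omega⟩)

/-- Consider a loop in the Cayley graph with four sides, sampled by the sequences `b`, `r`, `l`,
`t` of group elements (the bottom, right, left and top side), and suppose that it is a product of
at most `N` conjugates of relations of length at most `ρ`. Then the loop is null-homotopic, in the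
sense of labellings in groups, in the complex spanned at scale `10 ρ` by its sample points and at
most `N` further points, and this complex is connected. -/
theorem exists_coarse_filling (X : Finset G) (hX : Subgroup.closure (X : Set G) = ⊤)
    (k N : ℕ) {ρ : ℝ} (hρ : 1 ≤ ρ) (g : G) (b r l t : ℕ → FreeGroup X)
    (hb0 : b 0 = 1) (hl0 : l 0 = 1) (hr0 : r 0 = b k) (ht0 : t 0 = l k)
    (hrt : eval X (r k) = eval X (t k))
    (hb : ∀ j, (len X ((b j)⁻¹ * b (j + 1)) : ℝ) ≤ ρ)
    (hr : ∀ j, (len X ((r j)⁻¹ * r (j + 1)) : ℝ) ≤ ρ)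
    (hl : ∀ j, (len X ((l j)⁻¹ * l (j + 1)) : ℝ) ≤ ρ)
    (ht : ∀ j, (len X ((t j)⁻¹ * t (j + 1)) : ℝ) ≤ ρ)
    (hbk : ∀ j, k ≤ j → b j = b k) (hrk : ∀ j, k ≤ j → r j = r k)
    (hlk : ∀ j, k ≤ j → l j = l k) (htk : ∀ j, k ≤ j → t j = t k)
    (hw : ∃ n ≤ N, IsProdOfConj {R | eval X R = 1 ∧ (len X R : ℝ) ≤ ρ} (r k * (t k)⁻¹) n) :
    ∃ V : FillIndex k N → G,
      (∀ j, V (gridIndex k N j 0) = g * eval X (b j)) ∧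
      (∀ j, V (gridIndex k N k j) = g * eval X (r j)) ∧
      (∀ j, V (gridIndex k N 0 j) = g * eval X (l j)) ∧
      (∀ j, V (gridIndex k N j k) = g * eval X (t j)) ∧
      (∀ u, Relation.ReflTransGen (fun u v => wordDist X (V u) (V v) ≤ 10 * ρ)
        (gridIndex k N 0 0) u) ∧
      ∀ (Q : Type) [Group Q] (e : FillIndex k N → FillIndex k N → Q),
        (∀ u v z, wordDist X (V u) (V v) ≤ 10 * ρ → wordDist X (V v) (V z) ≤ 10 * ρ →
          wordDist X (V u) (V z) ≤ 10 * ρ → e u v * e v z = e u z) →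
        ((List.range k).map fun j => e (gridIndex k N j 0) (gridIndex k N (j + 1) 0)).prod *
        ((List.range k).map fun j => e (gridIndex k N k j) (gridIndex k N k (j + 1))).prod =
        ((List.range k).map fun j => e (gridIndex k N 0 j) (gridIndex k N 0 (j + 1))).prod *
        ((List.range k).map fun j => e (gridIndex k N j k) (gridIndex k N (j + 1) k)).prod := by
  classical
  obtain ⟨n, hn, L, hLn, hL, hLw⟩ := hw
  have hL' : ∀ i : Fin n, ∃ f R : FreeGroup X, (eval X R = 1 ∧ (len X R : ℝ) ≤ ρ) ∧
      L[i]'(by omega) = f⁻¹ * R * f := by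
    intro i
    obtain ⟨f, R, hR, h | h⟩ := hL _ (List.getElem_mem (l := L) (n := i) (by omega))
    · exact ⟨f, R, hR, h⟩
    · refine ⟨f, R⁻¹, ⟨by rw [map_inv, hR.1, inv_one], by rw [len_inv]; exact hR.2⟩, h⟩
  choose f R hR hfR using hL'
  have comm := wordDist_comm hX
  have tri := wordDist_triangle hX
  -- The sample points of the sides, and the points at which the relations are read.
  let V₀ : FillIndex k N → G := Sum.elim
    (fun p => g * eval X (if (p.2 : ℕ) = 0 then b p.1 else if (p.1 : ℕ) = k then r p.2 else
      if (p.1 : ℕ) = 0 then l p.2 else t p.1))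
    (fun i => if h : (i : ℕ) < n then g * (eval X (f ⟨i, h⟩))⁻¹ else g)
  have h00 : V₀ (gridIndex k N 0 0) = g := by simp [V₀, gridIndex, hb0]
  have hVb : ∀ j, V₀ (gridIndex k N j 0) = g * eval X (b j) := by
    intro j
    simp only [V₀, gridIndex, Sum.elim_inl, zero_le, inf_of_le_left, if_true]
    rcases le_total j k with h | h
    · rw [min_eq_left h]
    · rw [min_eq_right h, hbk j h]
  have hVr : ∀ j, V₀ (gridIndex k N k j) = g * eval X (r j) := by
    intro j
    simp only [V₀, gridIndex, Sum.elim_inl, min_self, if_true]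
    rcases le_total j k with h | h
    · rw [min_eq_left h]
      split_ifs with h0
      · rw [h0, hr0]
      · rfl
    · rw [min_eq_right h, hrk j h]
      split_ifs with h0
      · rw [← hr0, hrk 0 (by omega)]
      · rfl
  have hVl : ∀ j, V₀ (gridIndex k N 0 j) = g * eval X (l j) := by
    intro j
    simp only [V₀, gridIndex, Sum.elim_inl, zero_le, inf_of_le_left, if_true]
    have hjj : l (min j k) = l j := by
      rcases le_total j k with h | h
      · rw [min_eq_left h]
      · rw [min_eq_right h, hlk j h]
    rw [hjj]
    split_ifs with h0 h1
    · rw [← hjj, h0, hb0, hl0]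
    · have : j ⊓ k = 0 := by omega
      exact absurd this h0
    · rfl
  have hVt : ∀ j, V₀ (gridIndex k N j k) = g * eval X (t j) := by
    intro j
    simp only [V₀, gridIndex, Sum.elim_inl, min_self]
    have hjj : t (min j k) = t j := by
      rcases le_total j k with h | h
      · rw [min_eq_left h]
      · rw [min_eq_right h, htk j h]
    split_ifs with h0 h1 h2
    · subst h0
      rw [hbk _ (Nat.zero_le _), htk j (Nat.zero_le _), ht0, hb0, hl0]
    · rw [← hjj, h1, hrt]
    · rw [← hjj, h2, ht0]
    · rw [hjj]
  let A₀ : FillIndex k N → FillIndex k N → Prop := fun u v => wordDist X (V₀ u) (V₀ v) ≤ 10 * ρ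
  have chain : ∀ (c : ℕ → FillIndex k N) (q : ℕ → FreeGroup X),
      (∀ j, V₀ (c j) = g * eval X (q j)) →
      (∀ j, (len X ((q j)⁻¹ * q (j + 1)) : ℝ) ≤ ρ) →
      Relation.ReflTransGen A₀ (gridIndex k N 0 0) (c 0) →
      ∀ j, Relation.ReflTransGen A₀ (gridIndex k N 0 0) (c j) := by
    intro c q hc hq h0 j
    induction j with
    | zero => exact h0
    | succ j ih =>
      refine ih.tail ?_
      change wordDist X (V₀ (c j)) (V₀ (c (j + 1))) ≤ 10 * ρ
      rw [hc, hc]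
      linarith [wordDist_mul_eval_mul_eval_le X g (q j) (q (j + 1)), hq j]
  have hSb := chain (fun j => gridIndex k N j 0) b hVb hb Relation.ReflTransGen.refl
  have hSl := chain (fun j => gridIndex k N 0 j) l hVl hl Relation.ReflTransGen.refl
  have hSr := chain (fun j => gridIndex k N k j) r hVr hr (hSb k)
  have hSt := chain (fun j => gridIndex k N j k) t hVt ht (hSl k)
  -- Points that cannot be reached from the loop are moved to its base point.
  let V : FillIndex k N → G := fun u =>
    if Relation.ReflTransGen A₀ (gridIndex k N 0 0) u then V₀ u else g
  have hVS : ∀ u, Relation.ReflTransGen A₀ (gridIndex k N 0 0) u → V u = V₀ u :=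
    fun u hu => if_pos hu
  have hV00 : V (gridIndex k N 0 0) = g := by rw [hVS _ Relation.ReflTransGen.refl, h00]
  have hVb' : ∀ j, V (gridIndex k N j 0) = g * eval X (b j) := fun j => by rw [hVS _ (hSb j), hVb]
  have hVr' : ∀ j, V (gridIndex k N k j) = g * eval X (r j) := fun j => by rw [hVS _ (hSr j), hVr]
  have hVl' : ∀ j, V (gridIndex k N 0 j) = g * eval X (l j) := fun j => by rw [hVS _ (hSl j), hVl]
  have hVt' : ∀ j, V (gridIndex k N j k) = g * eval X (t j) := fun j => by rw [hVS _ (hSt j), hVt]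
  refine ⟨V, hVb', hVr', hVl', hVt', ?_, ?_⟩
  · intro u
    by_cases hu : Relation.ReflTransGen A₀ (gridIndex k N 0 0) u
    · induction hu with
      | refl => exact Relation.ReflTransGen.refl
      | @tail a c ha hac ih =>
        refine ih.tail ?_
        rw [hVS _ ha, hVS _ (ha.tail hac)]
        exact hac
    · refine Relation.ReflTransGen.single ?_
      rw [hV00, show V u = g from if_neg hu, wordDist_self]
      linarith
  · intro Q _ e he
    have : Nonempty (FillIndex k N) := ⟨gridIndex k N 0 0⟩
    obtain ⟨Φ, hΦ, hΦR, ψ, hψ⟩ := exists_coarse_holonomy X hX V hρ e he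
    have hΦone : ∀ g, Φ g 1 = 1 := by
      intro g
      have h := hΦ g 1 1
      simpa using h
    -- A base point of a relation is a member of `V`, or else far from `V`.
    have hconj : ∀ i : Fin n, Φ g ((f i)⁻¹ * R i * f i) = 1 := by
      intro i
      have h1 : Φ (g * eval X (f i)⁻¹) (R i) = 1 := by
        refine hΦR _ (hR i).1 (hR i).2 _ ?_
        have hp : V₀ (Sum.inr ⟨i, i.2.trans_le hn⟩) = g * eval X (f i)⁻¹ := by
          simp [V₀]
        by_cases hS : Relation.ReflTransGen A₀ (gridIndex k N 0 0) (Sum.inr ⟨i, i.2.trans_le hn⟩)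
        · exact Or.inl ⟨_, (hVS _ hS).trans hp⟩
        · right
          intro u
          obtain ⟨u', hu', hu⟩ : ∃ u', Relation.ReflTransGen A₀ (gridIndex k N 0 0) u' ∧
              V u = V₀ u' := by
            by_cases hu : Relation.ReflTransGen A₀ (gridIndex k N 0 0) u
            · exact ⟨u, hu, hVS u hu⟩
            · exact ⟨_, Relation.ReflTransGen.refl, (if_neg hu).trans h00.symm⟩
          by_contra hcon
          refine hS (hu'.tail ?_)
          change wordDist X (V₀ u') (V₀ _) ≤ 10 * ρ
          rw [hp, comm, ← hu]
          exact not_lt.1 hcon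
      rw [hΦ, hΦ, h1, mul_one, map_mul, (hR i).1, mul_one, ← hΦ, inv_mul_cancel, hΦone]
    have hprod : ∀ M : List (FreeGroup X), (∀ c ∈ M, Φ g c = 1 ∧ eval X c = 1) →
        Φ g M.prod = 1 := by
      intro M
      induction M with
      | nil => intro _; simp [hΦone]
      | cons a M ih =>
        intro hM
        have ha := hM a (by simp)
        rw [List.prod_cons, hΦ, ha.1, ha.2, mul_one, one_mul]
        exact ih fun c hc => hM c (by simp [hc])
    have hw1 : Φ g (r k * (t k)⁻¹) = 1 := by
      rw [← hLw]
      refine hprod L fun c hc => ?_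
      obtain ⟨i, hi, rfl⟩ := List.getElem_of_mem hc
      have h1 := hfR ⟨i, by omega⟩
      rw [show L[i] = _ from h1]
      refine ⟨hconj _, ?_⟩
      simp [(hR _).1]
    have hrt' : Φ g (r k) = Φ g (t k) := by
      have h1 : r k = r k * (t k)⁻¹ * t k := by group
      rw [h1, hΦ, hw1, one_mul, map_mul, map_inv, hrt, mul_inv_cancel, mul_one]
    have cb := holonomy_chain hΦ hψ g b _ hVb' hb k
    have cr := holonomy_chain hΦ hψ g r _ hVr' hr k
    have cl := holonomy_chain hΦ hψ g l _ hVl' hl k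
    have ct := holonomy_chain hΦ hψ g t _ hVt' ht k
    rw [hr0, cb, hb0, hΦone] at cr
    rw [ht0, cl, hl0, hΦone] at ct
    rw [cr, ct] at hrt'
    simp only [one_mul, mul_assoc, mul_inv_cancel_left, mul_right_inj] at hrt'
    exact mul_right_cancel (b := ψ (gridIndex k N k k)) (by rw [mul_assoc, mul_assoc, hrt'])

end

/-! ### Squares from homotopies of paths -/

section

/-- A homotopy between two concatenations of two paths fills a square with these four sides. -/
theorem exists_square_of_homotopic {K : Type*} [TopologicalSpace K] {p₀₀ p₁₀ p₀₁ p₁₁ : K}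
    (b : Path p₀₀ p₁₀) (r : Path p₁₀ p₁₁) (l : Path p₀₀ p₀₁) (t : Path p₀₁ p₁₁)
    (h : (b.trans r).Homotopic (l.trans t)) :
    ∃ S : C(I × I, K), (∀ x, S (x, 0) = b x) ∧ (∀ y, S (1, y) = r y) ∧ (∀ y, S (0, y) = l y) ∧
      ∀ x, S (x, 1) = t x := by
  obtain ⟨H⟩ := h
  have zero_le_one' : (0 : ℝ) ≤ 1 := zero_le_one
  -- The antidiagonals of the square are mapped affinely to the tracks of points of the paths.
  let τ : I × I → I := fun z => ⟨((z.1 : ℝ) + z.2) / 2, by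
    have := z.1.2; have := z.2.2; constructor <;> grind⟩
  let mn : I × I → ℝ := fun z => min ((z.1 : ℝ) + z.2) (2 - z.1 - z.2)
  let s : I × I → ℝ := fun z => 1 / 2 + ((z.2 : ℝ) - z.1) / (2 * mn z)
  let sg : I × I → I := fun z => Set.projIcc 0 1 zero_le_one' (s z)
  have hτ : Continuous τ := by
    apply Continuous.subtype_mk
    fun_prop
  have hmn : Continuous mn := by
    simp only [mn]
    fun_prop
  have hcor : ∀ z, mn z = 0 → τ z = 0 ∨ τ z = 1 := by
    intro z hz
    simp only [mn] at hz
    rcases min_choice ((z.1 : ℝ) + z.2) (2 - z.1 - z.2) with h | h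
    · left; ext; simp only [τ, Set.Icc.coe_zero]; linarith
    · right; ext; simp only [τ, Set.Icc.coe_one]; linarith
  have hcont : Continuous fun z => H (sg z, τ z) := by
    rw [continuous_iff_continuousAt]
    intro z
    by_cases hz : mn z = 0
    · -- At two opposite corners `sg` jumps, but `H` does not depend on its first argument there.
      have hcorner : ∀ s, H (s, τ z) = H (sg z, τ z) := by
        intro s
        rcases hcor z hz with h | h <;> rw [h] <;> simp
      rw [ContinuousAt]
      intro U hU
      have hev : ∀ᶠ a in 𝓝 (τ z), ∀ s ∈ (Set.univ : Set I), H (s, a) ∈ U := by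
        refine isCompact_univ.eventually_forall_of_forall_eventually fun s _ => ?_
        have hc : ContinuousAt (fun w : I × I => H (w.2, w.1)) (τ z, s) := by
          have : Continuous fun w : I × I => H (w.2, w.1) := by fun_prop
          exact this.continuousAt
        refine hc.eventually_mem ?_
        simp only
        rw [hcorner s]
        exact hU
      have := hτ.continuousAt.eventually hev
      exact this.mono fun w hw => hw (sg w) (Set.mem_univ _)
    · have hs : ContinuousAt s z := by
        refine continuousAt_const.add (ContinuousAt.div ?_ ?_ ?_)
        · exact Continuous.continuousAt (by fun_prop)
        · exact Continuous.continuousAt (by fun_prop)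
        · simpa using hz
      have hsg : ContinuousAt sg z := continuous_projIcc.continuousAt.comp hs
      exact H.continuous.continuousAt.comp (hsg.prodMk hτ.continuousAt)
  have hend : ∀ z, mn z = 0 → ∀ s s', H (s, τ z) = H (s', τ z) := by
    intro z hz s s'
    rcases hcor z hz with h | h <;> rw [h] <;> simp
  have hlow : ∀ z : I × I, ((z.2 : ℝ) = 0 ∨ (z.1 : ℝ) = 1) →
      H (sg z, τ z) = (b.trans r) (τ z) := by
    intro z hz
    have h1 := z.1.2
    have h2 := z.2.2
    refine Eq.trans ?_ (H.apply_zero (τ z))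
    by_cases h0 : mn z = 0
    · exact hend z h0 _ _
    · congr 2
      apply Set.projIcc_of_le_left
      have h3 : (z.2 : ℝ) - z.1 = - mn z := by
        rcases hz with h | h
        · simp only [mn]; rw [min_eq_left (by rw [h]; linarith [h1.2])]; linarith
        · simp only [mn]; rw [min_eq_right (by rw [h]; linarith [h2.1])]; linarith
      simp only [s]
      rw [h3]
      apply le_of_eq
      field_simp
      norm_num
  have hupp : ∀ z : I × I, ((z.1 : ℝ) = 0 ∨ (z.2 : ℝ) = 1) →
      H (sg z, τ z) = (l.trans t) (τ z) := by
    intro z hz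
    have h1 := z.1.2
    have h2 := z.2.2
    refine Eq.trans ?_ (H.apply_one (τ z))
    by_cases h0 : mn z = 0
    · exact hend z h0 _ _
    · congr 2
      apply Set.projIcc_of_right_le
      have h3 : (z.2 : ℝ) - z.1 = mn z := by
        rcases hz with h | h
        · simp only [mn]; rw [min_eq_left (by rw [h]; linarith [h2.2])]; linarith
        · simp only [mn]; rw [min_eq_right (by rw [h]; linarith [h1.1])]; linarith
      simp only [s]
      rw [h3]
      apply le_of_eq
      field_simp
      norm_num
  have hfst : ∀ {q : K} (p : Path p₀₀ q) (p' : Path q p₁₁) (x a : I), (a : ℝ) = x / 2 →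
      (p.trans p') a = p x := by
    intro q p p' x a ha
    rw [Path.trans_apply, dif_pos (by rw [ha]; linarith [x.2.2])]
    congr 1; ext; simp only [ha]; ring
  have hsnd : ∀ {q : K} (p : Path p₀₀ q) (p' : Path q p₁₁) (y a : I), (a : ℝ) = (1 + y) / 2 →
      (p.trans p') a = p' y := by
    intro q p p' y a ha
    by_cases hy : y = 0
    · subst hy
      rw [hfst p p' 1 a (by rw [ha]; simp)]
      simp
    · have hy' : (0 : ℝ) < y := lt_of_le_of_ne y.2.1 fun h => hy (by ext; exact h.symm)
      rw [Path.trans_apply, dif_neg (by rw [ha]; linarith)]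
      congr 1; ext; simp only [ha]; ring
  refine ⟨⟨_, hcont⟩, fun x => ?_, fun y => ?_, fun y => ?_, fun x => ?_⟩
  · exact (hlow (x, 0) (by simp)).trans (hfst _ _ _ _ (by simp [τ]))
  · exact (hlow (1, y) (by simp)).trans (hsnd _ _ _ _ (by simp [τ]))
  · exact (hupp (0, y) (by simp)).trans (hfst _ _ _ _ (by simp [τ]))
  · exact (hupp (x, 1) (by simp)).trans (hsnd _ _ _ _ (by simp [τ, add_comm]))

/-! ### Geometric realizations of clique complexes -/

variable {J : Type*} [Fintype J]

/-- The geometric realization of the clique complex of a finite graph: the points of the standard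
simplex on the vertices whose support is a clique. -/
def cliqueComplex (Γ : SimpleGraph J) : Set (J → ℝ) :=
  {μ | μ ∈ stdSimplex ℝ J ∧ Γ.IsClique (Function.support μ)}

/-- Segments whose ends are supported on a common clique lie in the clique complex. -/
theorem convexComb_mem_cliqueComplex {Γ : SimpleGraph J} {c : Set J} (hc : Γ.IsClique c)
    {μ ν : J → ℝ} (hμ : μ ∈ cliqueComplex Γ) (hν : ν ∈ cliqueComplex Γ)
    (hμc : Function.support μ ⊆ c) (hνc : Function.support ν ⊆ c) (s : I) :
    (1 - (s : ℝ)) • μ + (s : ℝ) • ν ∈ cliqueComplex Γ ∧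
      Function.support ((1 - (s : ℝ)) • μ + (s : ℝ) • ν) ⊆ c := by
  have hsup : Function.support ((1 - (s : ℝ)) • μ + (s : ℝ) • ν) ⊆ c := by
    intro u hu
    by_contra h
    have h1 : μ u = 0 := by_contra fun h' => h (hμc h')
    have h2 : ν u = 0 := by_contra fun h' => h (hνc h')
    exact hu (by simp [h1, h2])
  refine ⟨⟨?_, hc.subset hsup⟩, hsup⟩
  exact convex_stdSimplex ℝ J hμ.1 hν.1 (by linarith [s.2.2]) s.2.1 (by ring)

/-- Paths inside a common simplex are homotopic. -/
theorem homotopic_of_support_subset {Γ : SimpleGraph J} {c : Set J} (hc : Γ.IsClique c)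
    {x y : cliqueComplex Γ} (p q : Path x y) (hp : ∀ s, Function.support (p s : J → ℝ) ⊆ c)
    (hq : ∀ s, Function.support (q s : J → ℝ) ⊆ c) : p.Homotopic q := by
  refine ⟨⟨⟨⟨fun z => ⟨(1 - (z.1 : ℝ)) • (p z.2 : J → ℝ) + (z.1 : ℝ) • (q z.2 : J → ℝ),
    (convexComb_mem_cliqueComplex hc (p z.2).2 (q z.2).2 (hp _) (hq _) z.1).1⟩, ?_⟩, ?_, ?_⟩, ?_⟩⟩
  · apply Continuous.subtype_mk
    fun_prop
  · intro s; ext; simp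
  · intro s; ext; simp
  · intro s z hz
    ext u
    rcases hz with rfl | hz
    · simp [← add_mul]
    · rw [Set.mem_singleton_iff] at hz
      subst hz
      simp [← add_mul]

variable [DecidableEq J]

/-- The vertices of the clique complex. -/
def cliqueVertex (Γ : SimpleGraph J) (u : J) : cliqueComplex Γ :=
  ⟨Pi.single u 1, single_mem_stdSimplex ℝ u,
    (SimpleGraph.isClique_singleton u).subset (Pi.support_single_subset)⟩

theorem support_cliqueVertex (Γ : SimpleGraph J) (u : J) :
    Function.support (cliqueVertex Γ u : J → ℝ) ⊆ {u} :=
  Pi.support_single_subset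

/-- The edges of the clique complex; degenerate edges, from a vertex to itself, are allowed. -/
def cliqueEdge (Γ : SimpleGraph J) {u v : J} (h : Γ.IsClique {u, v}) :
    Path (cliqueVertex Γ u) (cliqueVertex Γ v) where
  toFun s := ⟨(1 - (s : ℝ)) • (cliqueVertex Γ u : J → ℝ) + (s : ℝ) • (cliqueVertex Γ v : J → ℝ),
    (convexComb_mem_cliqueComplex h (cliqueVertex Γ u).2 (cliqueVertex Γ v).2
      ((support_cliqueVertex Γ u).trans (by simp)) ((support_cliqueVertex Γ v).trans (by simp))
      s).1⟩
  continuous_toFun := by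
    apply Continuous.subtype_mk
    fun_prop
  source' := by ext; simp
  target' := by ext; simp

theorem support_cliqueEdge (Γ : SimpleGraph J) {u v : J} (h : Γ.IsClique {u, v}) (s : I) :
    Function.support (cliqueEdge Γ h s : J → ℝ) ⊆ {u, v} :=
  (convexComb_mem_cliqueComplex h (cliqueVertex Γ u).2 (cliqueVertex Γ v).2
      ((support_cliqueVertex Γ u).trans (by simp)) ((support_cliqueVertex Γ v).trans (by simp))
      s).2

/-- The boundary of a triangle of the clique complex is null-homotopic. -/
theorem cliqueEdge_trans_homotopic {Γ : SimpleGraph J} {u v z : J} (huv : Γ.IsClique {u, v})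
    (hvz : Γ.IsClique {v, z}) (huz : Γ.IsClique {u, z}) :
    ((cliqueEdge Γ huv).trans (cliqueEdge Γ hvz)).Homotopic (cliqueEdge Γ huz) := by
  have hc : Γ.IsClique {u, v, z} := by
    rw [SimpleGraph.isClique_pair] at *
    rw [SimpleGraph.isClique_insert, SimpleGraph.isClique_pair]
    refine ⟨hvz, ?_⟩
    rintro w (rfl | rfl) hw
    exacts [huv hw, huz hw]
  refine homotopic_of_support_subset hc _ _ (fun s => ?_) fun s => ?_
  · have h := Set.mem_range_self (f := (cliqueEdge Γ huv).trans (cliqueEdge Γ hvz)) s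
    rw [Path.trans_range] at h
    rcases h with ⟨s', h⟩ | ⟨s', h⟩
    · rw [← h]
      exact (support_cliqueEdge Γ huv s').trans (by grind)
    · rw [← h]
      exact (support_cliqueEdge Γ hvz s').trans (by grind)
  · exact (support_cliqueEdge Γ huz s).trans (by grind)

/-- The path in the clique complex through the `2 ^ m + 1` vertices `c a, c (a + 1), …`, with
constant speed. -/
def cliqueChain (Γ : SimpleGraph J) (c : ℕ → J) (hc : ∀ j, Γ.IsClique {c j, c (j + 1)}) :
    ∀ m a : ℕ, Path (cliqueVertex Γ (c a)) (cliqueVertex Γ (c (a + 2 ^ m)))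
  | 0, a => cliqueEdge Γ (hc a)
  | m + 1, a => ((cliqueChain Γ c hc m a).trans (cliqueChain Γ c hc m (a + 2 ^ m))).cast rfl
      (by rw [pow_succ, mul_two, add_assoc])

/-- At parameter `s`, the chain through `2 ^ m` edges is on an edge with number close to
`2 ^ m * s`. -/
theorem support_cliqueChain (Γ : SimpleGraph J) (c : ℕ → J)
    (hc : ∀ j, Γ.IsClique {c j, c (j + 1)}) (m : ℕ) : ∀ (a : ℕ) (s : I), ∃ j : ℕ, j < 2 ^ m ∧
      (j : ℝ) ≤ 2 ^ m * s ∧ 2 ^ m * s ≤ (j : ℝ) + 1 ∧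
      Function.support (cliqueChain Γ c hc m a s : J → ℝ) ⊆ {c (a + j), c (a + j + 1)} := by
  induction m with
  | zero =>
    intro a s
    refine ⟨0, by simp, by simp [s.2.1], by simp [s.2.2], ?_⟩
    exact support_cliqueEdge Γ (hc a) s
  | succ m ih =>
    intro a s
    rw [cliqueChain, Path.cast_coe, Path.trans_apply]
    have h2 : (2 : ℕ) ^ (m + 1) = 2 ^ m + 2 ^ m := by ring
    split_ifs with h
    · obtain ⟨j, hj, h1, h2', h3⟩ := ih a ⟨2 * s, by linarith [s.2.1], by linarith⟩
      refine ⟨j, by omega, ?_, ?_, h3⟩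
      · simp only at h1; rw [pow_succ]; linarith
      · simp only at h2'; rw [pow_succ]; linarith
    · obtain ⟨j, hj, h1, h2', h3⟩ := ih (a + 2 ^ m) ⟨2 * s - 1, by linarith, by linarith [s.2.2]⟩
      refine ⟨2 ^ m + j, by omega, ?_, ?_, ?_⟩
      · simp only at h1; push_cast; rw [pow_succ]; linarith
      · simp only at h2'; push_cast; rw [pow_succ]; linarith
      · rw [← add_assoc]; exact h3

open Classical in
/-- The labelling of pairs of vertices by elements of the fundamental group obtained from
a choice of paths to the vertices. The opposite group appears because the multiplication of the
fundamental group is the reverse of concatenation. -/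
def edgeLabel (Γ : SimpleGraph J) {x : cliqueComplex Γ} (P : ∀ u, Path x (cliqueVertex Γ u))
    (u v : J) : (FundamentalGroup (cliqueComplex Γ) x)ᵐᵒᵖ :=
  if h : Γ.IsClique {u, v} then MulOpposite.op (FundamentalGroup.fromPath (Path.Homotopic.Quotient.mk
    (((P u).trans (cliqueEdge Γ h)).trans (P v).symm))) else 1

theorem op_mul_op_eq {Z : Type*} [TopologicalSpace Z] {x y z w : Z} (p : Path x y) (a : Path y z)
    (q : Path x z) (b : Path z w) (r : Path x w) :
    (MulOpposite.op (FundamentalGroup.fromPath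
      (Path.Homotopic.Quotient.mk ((p.trans a).trans q.symm))) *
    MulOpposite.op (FundamentalGroup.fromPath
      (Path.Homotopic.Quotient.mk ((q.trans b).trans r.symm)))) =
    MulOpposite.op (FundamentalGroup.fromPath
      (Path.Homotopic.Quotient.mk ((p.trans (a.trans b)).trans r.symm))) := by
  rw [← MulOpposite.op_mul]
  congr 1
  change Path.Homotopic.Quotient.trans _ _ = _
  simp only [FundamentalGroup.fromPath, FundamentalGroup.fromArrow,
    Path.Homotopic.Quotient.mk_trans, Path.Homotopic.Quotient.mk_symm]
  grind

theorem edgeLabel_mul (Γ : SimpleGraph J) {x : cliqueComplex Γ}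
    (P : ∀ u, Path x (cliqueVertex Γ u)) {u v z : J} (huv : Γ.IsClique {u, v})
    (hvz : Γ.IsClique {v, z}) (huz : Γ.IsClique {u, z}) :
    edgeLabel Γ P u v * edgeLabel Γ P v z = edgeLabel Γ P u z := by
  rw [edgeLabel, edgeLabel, edgeLabel, dif_pos huv, dif_pos hvz, dif_pos huz, op_mul_op_eq]
  congr 2
  rw [Path.Homotopic.Quotient.eq]
  exact ((Path.Homotopic.refl _).hcomp (cliqueEdge_trans_homotopic huv hvz huz)).hcomp
    (Path.Homotopic.refl _)

theorem edgeLabel_chain (Γ : SimpleGraph J) {x : cliqueComplex Γ}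
    (P : ∀ u, Path x (cliqueVertex Γ u)) (c : ℕ → J) (hc : ∀ j, Γ.IsClique {c j, c (j + 1)})
    (m : ℕ) : ∀ a, ((List.range (2 ^ m)).map fun j =>
        edgeLabel Γ P (c (a + j)) (c (a + j + 1))).prod =
      MulOpposite.op (FundamentalGroup.fromPath (Path.Homotopic.Quotient.mk
        (((P (c a)).trans (cliqueChain Γ c hc m a)).trans (P (c (a + 2 ^ m))).symm))) := by
  induction m with
  | zero =>
    intro a
    simp [edgeLabel, hc a, cliqueChain]
  | succ m ih =>
    intro a
    have h2 : (2 : ℕ) ^ (m + 1) = 2 ^ m + 2 ^ m := by ring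
    have key : ∀ (n : ℕ) (hn : a + 2 ^ m + 2 ^ m = n),
        ((List.range (2 ^ m + 2 ^ m)).map fun j =>
          edgeLabel Γ P (c (a + j)) (c (a + j + 1))).prod =
        MulOpposite.op (FundamentalGroup.fromPath (Path.Homotopic.Quotient.mk
          (((P (c a)).trans (((cliqueChain Γ c hc m a).trans
            (cliqueChain Γ c hc m (a + 2 ^ m))).cast rfl (by rw [hn]))).trans
              (P (c n)).symm))) := by
      rintro _ rfl
      rw [List.range_add, List.map_append, List.prod_append, ih a, List.map_map]
      have h3 := ih (a + 2 ^ m)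
      simp only [add_assoc] at h3
      simp only [Function.comp_def, add_assoc]
      rw [h3]
      exact op_mul_op_eq _ _ _ _ _
    exact (congrArg (fun n => ((List.range n).map fun j =>
      edgeLabel Γ P (c (a + j)) (c (a + j + 1))).prod) h2).trans (key _ (by ring))

/-- A chain of vertices is traversed by a path whose class is the product of the labels. -/
theorem exists_path_chain (Γ : SimpleGraph J) (c : ℕ → J) (hc : ∀ j, Γ.IsClique {c j, c (j + 1)})
    (m : ℕ) {u v : J} (hu : c 0 = u) (hv : c (2 ^ m) = v) :
    ∃ p : Path (cliqueVertex Γ u) (cliqueVertex Γ v),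
      (∀ s : I, ∃ j : ℕ, j < 2 ^ m ∧ (j : ℝ) ≤ 2 ^ m * s ∧ 2 ^ m * s ≤ (j : ℝ) + 1 ∧
        Function.support (p s : J → ℝ) ⊆ {c j, c (j + 1)}) ∧
      ∀ {x : cliqueComplex Γ} (P : ∀ u, Path x (cliqueVertex Γ u)),
        ((List.range (2 ^ m)).map fun j => edgeLabel Γ P (c j) (c (j + 1))).prod =
        MulOpposite.op (FundamentalGroup.fromPath (Path.Homotopic.Quotient.mk
          (((P u).trans p).trans (P v).symm))) := by
  subst hu hv
  have key : ∀ n, 0 + 2 ^ m = n → ∃ p : Path (cliqueVertex Γ (c 0)) (cliqueVertex Γ (c n)),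
      (∀ s : I, ∃ j : ℕ, j < 2 ^ m ∧ (j : ℝ) ≤ 2 ^ m * s ∧ 2 ^ m * s ≤ (j : ℝ) + 1 ∧
        Function.support (p s : J → ℝ) ⊆ {c j, c (j + 1)}) ∧
      ∀ {x : cliqueComplex Γ} (P : ∀ u, Path x (cliqueVertex Γ u)),
        ((List.range (2 ^ m)).map fun j => edgeLabel Γ P (c j) (c (j + 1))).prod =
        MulOpposite.op (FundamentalGroup.fromPath (Path.Homotopic.Quotient.mk
          (((P (c 0)).trans p).trans (P (c n)).symm))) := by
    rintro _ rfl
    refine ⟨cliqueChain Γ c hc m 0, fun s => ?_, fun P => ?_⟩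
    · simpa only [zero_add] using support_cliqueChain Γ c hc m 0 s
    · have h := edgeLabel_chain Γ P c hc m 0
      simpa only [Nat.zero_add] using h
  exact key _ (Nat.zero_add _)

/-- If a four-sided loop in a connected finite graph is killed by all labellings in groups that are
multiplicative on triangles, then it bounds a square in the clique complex. -/
theorem exists_square_cliqueComplex {J : Type} [Fintype J] [DecidableEq J]
    (Γ : SimpleGraph J) (m : ℕ) (b r l t : ℕ → J)
    (hconn : ∀ u, Γ.Reachable (b 0) u)
    (hb : ∀ j, Γ.IsClique {b j, b (j + 1)}) (hr : ∀ j, Γ.IsClique {r j, r (j + 1)})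
    (hl : ∀ j, Γ.IsClique {l j, l (j + 1)}) (ht : ∀ j, Γ.IsClique {t j, t (j + 1)})
    (hbl : b 0 = l 0) (hbr : b (2 ^ m) = r 0) (hlt : l (2 ^ m) = t 0)
    (hrt : r (2 ^ m) = t (2 ^ m))
    (hQ : ∀ (Q : Type) [Group Q] (e : J → J → Q),
      (∀ u v z, Γ.IsClique {u, v} → Γ.IsClique {v, z} → Γ.IsClique {u, z} →
        e u v * e v z = e u z) →
      ((List.range (2 ^ m)).map fun j => e (b j) (b (j + 1))).prod *
      ((List.range (2 ^ m)).map fun j => e (r j) (r (j + 1))).prod =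
      ((List.range (2 ^ m)).map fun j => e (l j) (l (j + 1))).prod *
      ((List.range (2 ^ m)).map fun j => e (t j) (t (j + 1))).prod) :
    ∃ S : C(I × I, cliqueComplex Γ),
      (∀ x : I, ∃ j : ℕ, j < 2 ^ m ∧ (j : ℝ) ≤ 2 ^ m * x ∧ 2 ^ m * x ≤ (j : ℝ) + 1 ∧
        Function.support (S (x, 0) : J → ℝ) ⊆ {b j, b (j + 1)}) ∧
      (∀ x : I, ∃ j : ℕ, j < 2 ^ m ∧ (j : ℝ) ≤ 2 ^ m * x ∧ 2 ^ m * x ≤ (j : ℝ) + 1 ∧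
        Function.support (S (1, x) : J → ℝ) ⊆ {r j, r (j + 1)}) ∧
      (∀ x : I, ∃ j : ℕ, j < 2 ^ m ∧ (j : ℝ) ≤ 2 ^ m * x ∧ 2 ^ m * x ≤ (j : ℝ) + 1 ∧
        Function.support (S (0, x) : J → ℝ) ⊆ {l j, l (j + 1)}) ∧
      (∀ x : I, ∃ j : ℕ, j < 2 ^ m ∧ (j : ℝ) ≤ 2 ^ m * x ∧ 2 ^ m * x ≤ (j : ℝ) + 1 ∧
        Function.support (S (x, 1) : J → ℝ) ⊆ {t j, t (j + 1)}) := by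
  have hjoin : ∀ u, Joined (cliqueVertex Γ (b 0)) (cliqueVertex Γ u) := by
    intro u
    obtain ⟨w⟩ := hconn u
    generalize b 0 = v at w
    induction w with
    | nil => exact Joined.refl _
    | cons h _ ih =>
      exact Joined.trans ⟨cliqueEdge Γ (SimpleGraph.isClique_pair.2 fun _ => h)⟩ ih
  let P := fun u => (hjoin u).somePath
  have hprod := hQ _ (edgeLabel Γ P) fun u v z => edgeLabel_mul Γ P
  obtain ⟨pb, sb, cb⟩ := exists_path_chain Γ b hb m rfl hbr
  obtain ⟨pr, sr, cr⟩ := exists_path_chain Γ r hr m rfl hrt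
  obtain ⟨pl, sl, cl⟩ := exists_path_chain Γ l hl m hbl.symm hlt
  obtain ⟨pt, st, ct⟩ := exists_path_chain Γ t ht m rfl rfl
  rw [cb, cr, cl, ct, op_mul_op_eq, op_mul_op_eq] at hprod
  have hhom : (pb.trans pr).Homotopic (pl.trans pt) := by
    have h1 := MulOpposite.op_injective hprod
    simp only [FundamentalGroup.fromPath, FundamentalGroup.fromArrow] at h1
    rw [← Path.Homotopic.Quotient.eq]
    have h2 : ∀ p : Path (cliqueVertex Γ (b 0)) (cliqueVertex Γ (t (2 ^ m))),
        Path.Homotopic.Quotient.mk p =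
        ((Path.Homotopic.Quotient.mk (P (b 0))).symm.trans (Path.Homotopic.Quotient.mk
          (((P (b 0)).trans p).trans (P (t (2 ^ m))).symm))).trans
          (Path.Homotopic.Quotient.mk (P (t (2 ^ m)))) := by
      intro p
      simp only [Path.Homotopic.Quotient.mk_trans, Path.Homotopic.Quotient.mk_symm]
      grind
    rw [h2 (pb.trans pr), h2 (pl.trans pt), h1]
  obtain ⟨S, hS1, hS2, hS3, hS4⟩ := exists_square_of_homotopic pb pr pl pt hhom
  refine ⟨S, fun x => ?_, fun x => ?_, fun x => ?_, fun x => ?_⟩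
  · rw [hS1]; exact sb x
  · rw [hS2]; exact sr x
  · rw [hS3]; exact sl x
  · rw [hS4]; exact st x

end

/-! ### Approximately continuous maps and their refinement -/

section

/-- A map to a metric space is `δ`-continuous if its jumps are at most `δ`. -/
def QuasiContinuous {Z T : Type*} [TopologicalSpace Z] [PseudoMetricSpace T] (δ : ℝ)
    (f : Z → T) : Prop :=
  ∀ p, ∀ᶠ q in 𝓝 p, dist (f p) (f q) ≤ δ

theorem QuasiContinuous.comp {Z W T : Type*} [TopologicalSpace Z] [TopologicalSpace W]
    [PseudoMetricSpace T] {δ : ℝ} {f : Z → T} (hf : QuasiContinuous δ f) {g : W → Z}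
    (hg : Continuous g) : QuasiContinuous δ (f ∘ g) :=
  fun p => hg.continuousAt.eventually (hf (g p))

theorem QuasiContinuous.of_dist_le {Z T : Type*} [TopologicalSpace Z] [PseudoMetricSpace T]
    {δ η : ℝ} {f g : Z → T} (hf : QuasiContinuous δ f) (h : ∀ z, dist (f z) (g z) ≤ η) :
    QuasiContinuous (δ + 2 * η) g := by
  intro p
  filter_upwards [hf p] with q hq
  have h1 := dist_triangle4 (g p) (f p) (f q) (g q)
  have h2 := h p
  have h3 := h q
  rw [dist_comm] at h2
  linarith

theorem QuasiContinuous.mono {Z T : Type*} [TopologicalSpace Z] [PseudoMetricSpace T]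
    {δ η : ℝ} {f : Z → T} (hf : QuasiContinuous δ f) (h : δ ≤ η) : QuasiContinuous η f :=
  fun p => (hf p).mono fun _ hq => hq.trans h

/-- On a compact space, a `δ`-continuous map varies by at most `2 δ` at a uniform scale. -/
theorem QuasiContinuous.exists_uniform {Z T : Type*} [PseudoMetricSpace Z] [CompactSpace Z]
    [PseudoMetricSpace T] {δ : ℝ} {f : Z → T} (hf : QuasiContinuous δ f) :
    ∃ ρ > 0, ∀ z w, dist z w < ρ → dist (f z) (f w) ≤ 2 * δ := by
  obtain ⟨ρ, hρ, h⟩ := lebesgue_number_lemma_of_metric (s := (Set.univ : Set Z))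
    (c := fun p => interior {q | dist (f p) (f q) ≤ δ}) isCompact_univ
    (fun p => isOpen_interior) (fun p _ => Set.mem_iUnion.2 ⟨p, mem_interior_iff_mem_nhds.2 (hf p)⟩)
  refine ⟨ρ, hρ, fun z w hzw => ?_⟩
  obtain ⟨p, hp⟩ := h z (Set.mem_univ _)
  have h1 : dist (f p) (f z) ≤ δ :=
    interior_subset (s := {q | dist (f p) (f q) ≤ δ}) (hp (Metric.mem_ball_self hρ))
  have h2 : dist (f p) (f w) ≤ δ :=
    interior_subset (s := {q | dist (f p) (f q) ≤ δ}) (hp (by rwa [Metric.mem_ball']))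
  linarith [dist_triangle_left (f z) (f w) (f p)]

/-- The boundary of the unit square. -/
def squareBoundary : Set (I × I) := {z | (z.1 = 0 ∨ z.1 = 1) ∨ (z.2 = 0 ∨ z.2 = 1)}

theorem isCompact_squareBoundary : IsCompact squareBoundary := by
  apply IsClosed.isCompact
  apply IsClosed.union <;> apply IsClosed.union
  all_goals exact isClosed_eq (by fun_prop) continuous_const

/-- The quadrangle filling property at all scales: quadrangles of mesh `ε`, with sides from the
fixed family `E` of paths (which need not be continuous), bound `ε / 8`-continuous squares of
diameter `O(ε)`. Since the side from `p` to `q` only depends on `p` and `q`, squares filling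
adjacent quadrangles can be glued. -/
structure FillsQuadrangles {T : Type*} [PseudoMetricSpace T] (E : T → T → I → T) (A C : ℝ) :
    Prop where
  dist_le : ∀ p q s, dist p (E p q s) ≤ A * dist p q
  exists_fill : ∀ ε > 0, ∀ p₀₀ p₁₀ p₀₁ p₁₁ : T, dist p₀₀ p₁₀ ≤ ε → dist p₁₀ p₁₁ ≤ ε →
    dist p₀₀ p₀₁ ≤ ε → dist p₀₁ p₁₁ ≤ ε → ∃ F : I × I → T, QuasiContinuous (ε / 8) F ∧
      (∀ x, F (x, 0) = E p₀₀ p₁₀ x) ∧ (∀ x, F (x, 1) = E p₀₁ p₁₁ x) ∧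
      (∀ y, F (0, y) = E p₀₀ p₀₁ y) ∧ (∀ y, F (1, y) = E p₁₀ p₁₁ y) ∧
      ∀ z, dist p₀₀ (F z) ≤ C * ε

/-- Numbers close to `a` lie in a unit interval `[⌊b⌋, ⌊b⌋ + 1]` containing `a`, and there are only two
such intervals. -/
theorem eventually_floor (a : ℝ) :
    ∀ᶠ b : ℝ in 𝓝 a, (⌊b⌋ = ⌊a⌋ ∨ ⌊b⌋ = ⌊a⌋ - 1) ∧ (⌊b⌋ : ℝ) ≤ a ∧ a ≤ ⌊b⌋ + 1 := by
  have h1 : (⌈a⌉ : ℝ) - 1 < a := by linarith [Int.ceil_lt_add_one a]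
  have h2 : a < (⌊a⌋ : ℝ) + 1 := Int.lt_floor_add_one a
  filter_upwards [lt_mem_nhds h1, gt_mem_nhds h2] with b hb1 hb2
  have h3 : ⌈a⌉ - 1 ≤ ⌊b⌋ := Int.le_floor.2 (by push_cast; exact hb1.le)
  have h4 : ⌊b⌋ < ⌊a⌋ + 1 := Int.floor_lt.2 (by push_cast; exact hb2)
  have h5 : ⌊a⌋ ≤ ⌈a⌉ := Int.floor_le_ceil a
  refine ⟨by omega, ?_, ?_⟩
  · have : (⌊b⌋ : ℝ) ≤ ⌊a⌋ := by exact_mod_cast Int.lt_add_one_iff.1 h4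
    exact this.trans (Int.floor_le a)
  · have : (⌈a⌉ : ℝ) - 1 ≤ ⌊b⌋ := by exact_mod_cast h3
    linarith [Int.le_ceil a]

/-- A `δ`-continuous map of the square can be replaced by a `δ / 2`-continuous one with the same
continuous boundary values at distance `O(δ)`: it is restricted to the vertices of a fine grid,
and the cells of the grid are filled. -/
theorem exists_refinement {T : Type*} [PseudoMetricSpace T] {E : T → T → I → T} {A C : ℝ}
    (hE : FillsQuadrangles E A C) (hA : 0 ≤ A) {h : I × I → T}
    (hh : ContinuousOn h squareBoundary) {δ : ℝ} (hδ : 0 < δ) {f : I × I → T}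
    (hf : QuasiContinuous δ f) (hfh : ∀ z ∈ squareBoundary, f z = h z) :
    ∃ f' : I × I → T, QuasiContinuous (δ / 2) f' ∧ (∀ z ∈ squareBoundary, f' z = h z) ∧
      ∀ z, dist (f z) (f' z) ≤ (2 * |C| + 2) * δ := by
  classical
  obtain ⟨ρ₁, hρ₁, hf₁⟩ := hf.exists_uniform
  set η := δ / (8 * (1 + A)) with hη
  have hη0 : 0 < η := by positivity
  have hηA : A * η + η = δ / 8 := by rw [hη]; field_simp; ring
  obtain ⟨ρ₂, hρ₂, hh₂⟩ := Metric.uniformContinuousOn_iff.1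
    (isCompact_squareBoundary.uniformContinuousOn_of_continuous hh) η hη0
  obtain ⟨n, hn⟩ := exists_nat_gt (max (1 / ρ₁) (1 / ρ₂))
  have hn1 : 1 / ρ₁ < n := (le_max_left _ _).trans_lt hn
  have hn2 : 1 / ρ₂ < n := (le_max_right _ _).trans_lt hn
  have hn0 : (0 : ℝ) < n := lt_trans (by positivity) hn1
  have hnρ₁ : 1 / (n : ℝ) < ρ₁ := by rwa [one_div_lt hn0 hρ₁]
  have hnρ₂ : 1 / (n : ℝ) < ρ₂ := by rwa [one_div_lt hn0 hρ₂]
  let pj : ℝ → I := Set.projIcc 0 1 zero_le_one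
  have hpj : ∀ a b : ℝ, dist (pj a) (pj b) ≤ |a - b| := fun a b => Set.abs_projIcc_sub_projIcc _
  have hpjI : ∀ x : I, pj x = x := fun x => Set.projIcc_val _ x
  have hpj0 : ∀ a ≤ (0 : ℝ), pj a = 0 := fun a ha => Set.projIcc_of_le_left _ ha
  have hpj1 : ∀ a, (1 : ℝ) ≤ a → pj a = 1 := fun a ha => Set.projIcc_of_right_le _ ha
  have hstep : ∀ i : ℤ, dist (pj (i / n)) (pj ((i + 1 : ℤ) / n)) ≤ 1 / n := by
    intro i
    refine (hpj _ _).trans ?_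
    rw [abs_sub_comm, ← sub_div]
    push_cast
    rw [add_sub_cancel_left, abs_of_nonneg (by positivity)]
  let pt : ℤ → ℤ → T := fun i j => f (pj (i / n), pj (j / n))
  have hptx : ∀ i j, dist (pt i j) (pt (i + 1) j) ≤ 2 * δ := by
    intro i j
    apply hf₁
    rw [Prod.dist_eq, dist_self, max_eq_left dist_nonneg]
    exact (hstep i).trans_lt hnρ₁
  have hpty : ∀ i j, dist (pt i j) (pt i (j + 1)) ≤ 2 * δ := by
    intro i j
    apply hf₁
    rw [Prod.dist_eq, dist_self, max_eq_right dist_nonneg]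
    exact (hstep j).trans_lt hnρ₁
  choose F hFq hFb hFt hFl hFr hFd using fun i j => hE.exists_fill (2 * δ) (by positivity)
    (pt i j) (pt (i + 1) j) (pt i (j + 1)) (pt (i + 1) (j + 1)) (hptx i j) (hpty (i + 1) j)
    (hpty i j) (hptx i (j + 1))
  let Gc : ℤ → ℤ → I × I → T := fun i j z => F i j (pj (n * z.1 - i), pj (n * z.2 - j))
  have hGq : ∀ i j, QuasiContinuous (δ / 4) (Gc i j) := by
    intro i j
    have h1 : Continuous fun z : I × I => (pj (n * z.1 - i), pj (n * z.2 - j)) := by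
      have : Continuous pj := continuous_projIcc
      fun_prop
    exact ((hFq i j).mono (by linarith)).comp h1
  let f₁ : I × I → T := fun z => Gc ⌊n * (z.1 : ℝ)⌋ ⌊n * (z.2 : ℝ)⌋ z
  -- Neighbouring cells agree on their common sides.
  have hGx : ∀ (z : I × I) (i j : ℤ), (i : ℝ) ≤ n * z.1 → n * (z.1 : ℝ) ≤ i + 1 →
      Gc i j z = Gc ⌊n * (z.1 : ℝ)⌋ j z := by
    intro z i j h1 h2
    by_cases h3 : ⌊n * (z.1 : ℝ)⌋ = i
    · rw [h3]
    · have h4 : i ≤ ⌊n * (z.1 : ℝ)⌋ := Int.le_floor.2 h1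
      have h5 : (((i + 1 : ℤ)) : ℝ) ≤ ⌊n * (z.1 : ℝ)⌋ := by
        exact_mod_cast (by omega : i + 1 ≤ ⌊n * (z.1 : ℝ)⌋)
      have h6 := Int.floor_le (n * (z.1 : ℝ))
      push_cast at h5
      have h7 : n * (z.1 : ℝ) = i + 1 := by linarith
      have h8 : ⌊n * (z.1 : ℝ)⌋ = i + 1 := by
        rw [Int.floor_eq_iff]; push_cast; constructor <;> linarith
      simp only [Gc]
      rw [h8, hpj1 _ (by linarith : (1 : ℝ) ≤ n * z.1 - i),
        hpj0 (n * z.1 - (i + 1 : ℤ)) (by push_cast; linarith), hFr, hFl]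
  have hGy : ∀ (z : I × I) (i j : ℤ), (j : ℝ) ≤ n * z.2 → n * (z.2 : ℝ) ≤ j + 1 →
      Gc i j z = Gc i ⌊n * (z.2 : ℝ)⌋ z := by
    intro z i j h1 h2
    by_cases h3 : ⌊n * (z.2 : ℝ)⌋ = j
    · rw [h3]
    · have h4 : j ≤ ⌊n * (z.2 : ℝ)⌋ := Int.le_floor.2 h1
      have h5 : (((j + 1 : ℤ)) : ℝ) ≤ ⌊n * (z.2 : ℝ)⌋ := by
        exact_mod_cast (by omega : j + 1 ≤ ⌊n * (z.2 : ℝ)⌋)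
      have h6 := Int.floor_le (n * (z.2 : ℝ))
      push_cast at h5
      have h7 : n * (z.2 : ℝ) = j + 1 := by linarith
      have h8 : ⌊n * (z.2 : ℝ)⌋ = j + 1 := by
        rw [Int.floor_eq_iff]; push_cast; constructor <;> linarith
      simp only [Gc]
      rw [h8, hpj1 _ (by linarith : (1 : ℝ) ≤ n * z.2 - j),
        hpj0 (n * z.2 - (j + 1 : ℤ)) (by push_cast; linarith), hFt, hFb]
  have hf₁q : QuasiContinuous (δ / 4) f₁ := by
    intro z
    have hx : Tendsto (fun w : I × I => n * (w.1 : ℝ)) (𝓝 z) (𝓝 (n * (z.1 : ℝ))) :=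
      Continuous.tendsto (by fun_prop) z
    have hy : Tendsto (fun w : I × I => n * (w.2 : ℝ)) (𝓝 z) (𝓝 (n * (z.2 : ℝ))) :=
      Continuous.tendsto (by fun_prop) z
    set a := ⌊n * (z.1 : ℝ)⌋
    set b := ⌊n * (z.2 : ℝ)⌋
    filter_upwards [hx.eventually (eventually_floor _), hy.eventually (eventually_floor _),
      hGq a b z, hGq (a - 1) b z, hGq a (b - 1) z, hGq (a - 1) (b - 1) z]
      with w hwx hwy h1 h2 h3 h4
    have e : f₁ z = Gc ⌊n * (w.1 : ℝ)⌋ ⌊n * (w.2 : ℝ)⌋ z :=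
      ((hGx z _ _ hwx.2.1 hwx.2.2).trans (hGy z _ _ hwy.2.1 hwy.2.2)).symm
    rw [e]
    change dist _ (Gc ⌊n * (w.1 : ℝ)⌋ ⌊n * (w.2 : ℝ)⌋ w) ≤ _
    rcases hwx.1 with hi | hi <;> rcases hwy.1 with hj | hj <;> rw [hi, hj]
    exacts [h1, h3, h2, h4]
  have hloc : ∀ x : I, dist (pj (⌊n * (x : ℝ)⌋ / n)) x ≤ 1 / n := by
    intro x
    conv_lhs => rw [← hpjI x]
    refine (hpj _ _).trans ?_
    have h1 := Int.floor_le (n * (x : ℝ))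
    have h2 := Int.lt_floor_add_one (n * (x : ℝ))
    rw [hpjI, abs_le]
    constructor
    · rw [neg_le_sub_iff_le_add, ← add_div, le_div_iff₀ hn0]; linarith
    · rw [sub_le_iff_le_add, div_le_iff₀ hn0, add_mul, one_div, inv_mul_cancel₀ hn0.ne']; linarith
  have hf₁d : ∀ z, dist (f z) (f₁ z) ≤ (2 * |C| + 2) * δ := by
    intro z
    have h1 : dist (pt ⌊n * (z.1 : ℝ)⌋ ⌊n * (z.2 : ℝ)⌋) (f z) ≤ 2 * δ := by
      apply hf₁
      rw [Prod.dist_eq]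
      exact (max_le (hloc z.1) (hloc z.2)).trans_lt hnρ₁
    have h2 : dist (pt ⌊n * (z.1 : ℝ)⌋ ⌊n * (z.2 : ℝ)⌋) (f₁ z) ≤ C * (2 * δ) := hFd _ _ _
    have h3 := dist_triangle_left (f z) (f₁ z) (pt ⌊n * (z.1 : ℝ)⌋ ⌊n * (z.2 : ℝ)⌋)
    have h4 : C * (2 * δ) ≤ |C| * (2 * δ) := by gcongr; exact le_abs_self C
    linarith
  -- On the boundary, the new map follows short sides between values of `h`.
  have hEh : ∀ (z u v : I × I) (s : I), z ∈ squareBoundary → u ∈ squareBoundary →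
      v ∈ squareBoundary → dist u v ≤ 1 / n → dist u z ≤ 1 / n →
      dist (E (f u) (f v) s) (h z) ≤ δ / 8 := by
    intro z u v s hz hu hv huv huz
    rw [hfh u hu, hfh v hv]
    have h1 := hE.dist_le (h u) (h v) s
    have h2 := hh₂ u hu v hv (huv.trans_lt hnρ₂)
    have h3 := hh₂ u hu z hz (huz.trans_lt hnρ₂)
    have h4 := dist_triangle_left (E (h u) (h v) s) (h z) (h u)
    have h5 : A * dist (h u) (h v) ≤ A * η := by gcongr
    linarith
  have hfloor : ∀ x : I, (x = 0 ∨ x = 1) → pj (⌊n * (x : ℝ)⌋ / n) = x ∧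
      pj (n * x - ⌊n * (x : ℝ)⌋) = 0 := by
    rintro x (rfl | rfl)
    · simp [hpj0]
    · simp [hpj0, hpj1, hn0.ne']
  have hf₁h : ∀ z ∈ squareBoundary, dist (f₁ z) (h z) ≤ δ / 8 := by
    intro z hz
    rcases hz with hz' | hz'
    · obtain ⟨h1, h2⟩ := hfloor z.1 hz'
      have e : f₁ z = E (pt ⌊n * (z.1 : ℝ)⌋ ⌊n * (z.2 : ℝ)⌋)
          (pt ⌊n * (z.1 : ℝ)⌋ (⌊n * (z.2 : ℝ)⌋ + 1)) (pj (n * z.2 - ⌊n * (z.2 : ℝ)⌋)) := by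
        simp only [f₁, Gc]
        rw [h2, hFl]
      rw [e]
      simp only [pt]
      rw [h1]
      refine hEh _ _ _ _ (Or.inl hz') (Or.inl hz') (Or.inl hz') ?_ ?_
      · rw [Prod.dist_eq, dist_self, max_eq_right dist_nonneg]; exact hstep _
      · rw [Prod.dist_eq, dist_self, max_eq_right dist_nonneg]; exact hloc _
    · obtain ⟨h1, h2⟩ := hfloor z.2 hz'
      have e : f₁ z = E (pt ⌊n * (z.1 : ℝ)⌋ ⌊n * (z.2 : ℝ)⌋)
          (pt (⌊n * (z.1 : ℝ)⌋ + 1) ⌊n * (z.2 : ℝ)⌋) (pj (n * z.1 - ⌊n * (z.1 : ℝ)⌋)) := by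
        simp only [f₁, Gc]
        rw [h2, hFb]
      rw [e]
      simp only [pt]
      rw [h1]
      refine hEh _ _ _ _ (Or.inr hz') (Or.inr hz') (Or.inr hz') ?_ ?_
      · rw [Prod.dist_eq, dist_self, max_eq_left dist_nonneg]; exact hstep _
      · rw [Prod.dist_eq, dist_self, max_eq_left dist_nonneg]; exact hloc _
  refine ⟨squareBoundary.piecewise h f₁, ?_, fun z hz => Set.piecewise_eq_of_mem _ _ _ hz, ?_⟩
  · have h1 : ∀ z, dist (f₁ z) (squareBoundary.piecewise h f₁ z) ≤ δ / 8 := by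
      intro z
      by_cases hz : z ∈ squareBoundary
      · rw [Set.piecewise_eq_of_mem _ _ _ hz]; exact hf₁h z hz
      · rw [Set.piecewise_eq_of_notMem _ _ _ hz, dist_self]; positivity
    exact (hf₁q.of_dist_le h1).mono (by linarith)
  · intro z
    by_cases hz : z ∈ squareBoundary
    · rw [Set.piecewise_eq_of_mem _ _ _ hz, hfh z hz, dist_self]; positivity
    · rw [Set.piecewise_eq_of_notMem _ _ _ hz]; exact hf₁d z

/-- In a complete space that fills quadrangles at all scales, continuous maps on the boundary of
the square extend to the square. -/
theorem exists_continuous_extension {T : Type*} [MetricSpace T] [CompleteSpace T]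
    {E : T → T → I → T} {A C : ℝ} (hE : FillsQuadrangles E A C) (hA : 0 ≤ A) {h : I × I → T}
    (hh : ContinuousOn h squareBoundary) :
    ∃ f : I × I → T, Continuous f ∧ ∀ z ∈ squareBoundary, f z = h z := by
  classical
  obtain ⟨D, hD⟩ := Metric.isBounded_iff.1 (isCompact_squareBoundary.image_of_continuousOn hh).isBounded
  have h00 : ((0, 0) : I × I) ∈ squareBoundary := by simp [squareBoundary]
  have hD0 : 0 ≤ D := by
    have := hD (Set.mem_image_of_mem h h00) (Set.mem_image_of_mem h h00)
    rwa [dist_self] at this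
  -- The first approximation is constant in the interior.
  let f₀ : I × I → T := squareBoundary.piecewise h fun _ => h (0, 0)
  have hf₀m : ∀ z, f₀ z ∈ h '' squareBoundary := by
    intro z
    by_cases hz : z ∈ squareBoundary
    · rw [show f₀ z = h z from Set.piecewise_eq_of_mem _ _ _ hz]; exact Set.mem_image_of_mem h hz
    · rw [show f₀ z = h (0, 0) from Set.piecewise_eq_of_notMem _ _ _ hz]
      exact Set.mem_image_of_mem h h00
  let ε : ℕ → ℝ := fun k => (D + 1) / 2 ^ k
  have hε : ∀ k, 0 < ε k := fun k => by positivity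
  have hε2 : ∀ k, ε k / 2 = ε (k + 1) := fun k => by simp only [ε]; rw [pow_succ]; field_simp
  let St (k : ℕ) : Type _ := {f : I × I → T // QuasiContinuous (ε k) f ∧
    ∀ z ∈ squareBoundary, f z = h z}
  have hnext : ∀ k (f : St k), ∃ f' : St (k + 1), ∀ z,
      dist (f.1 z) (f'.1 z) ≤ (2 * |C| + 2) * ε k := by
    rintro k ⟨f, hf, hfh⟩
    obtain ⟨f', h1, h2, h3⟩ := exists_refinement hE hA hh (hε k) hf hfh
    exact ⟨⟨f', by rw [← hε2]; exact h1, h2⟩, h3⟩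
  choose next hnext using hnext
  let start : St 0 := ⟨f₀, fun p => Eventually.of_forall fun q => by
      have := hD (hf₀m p) (hf₀m q)
      simp only [ε, pow_zero, div_one]
      linarith, fun z hz => Set.piecewise_eq_of_mem _ _ _ hz⟩
  let s : ∀ k, St k := fun k => Nat.rec start next k
  have hs : ∀ k z, dist ((s k).1 z) ((s (k + 1)).1 z) ≤
      (2 * ((2 * |C| + 2) * (D + 1))) / 2 / 2 ^ k := by
    intro k z
    refine (hnext k (s k) z).trans (le_of_eq ?_)
    simp only [ε]
    ring
  have hlim : ∀ z, ∃ a, Tendsto (fun k => (s k).1 z) atTop (𝓝 a) := fun z =>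
    cauchySeq_tendsto_of_complete (cauchySeq_of_le_geometric_two fun k => hs k z)
  choose f hf using hlim
  have hfd : ∀ k z, dist ((s k).1 z) (f z) ≤ 2 * ((2 * |C| + 2) * (D + 1)) / 2 ^ k :=
    fun k z => dist_le_of_le_geometric_two_of_tendsto (fun k => hs k z) (hf z) k
  refine ⟨f, ?_, fun z hz => ?_⟩
  · rw [continuous_iff_continuousAt]
    intro z
    rw [ContinuousAt, Metric.tendsto_nhds]
    intro e he
    set M := 2 * ((2 * |C| + 2) * (D + 1)) with hM
    have hsmall : Tendsto (fun k : ℕ => (2 * M + (D + 1)) * (1 / 2 : ℝ) ^ k) atTop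
        (𝓝 ((2 * M + (D + 1)) * 0)) :=
      (tendsto_pow_atTop_nhds_zero_of_lt_one (by norm_num) (by norm_num)).const_mul _
    rw [mul_zero] at hsmall
    obtain ⟨k, hk⟩ := (hsmall.eventually (gt_mem_nhds he)).exists
    filter_upwards [(s k).2.1 z] with w hw
    have h1 := hfd k z
    have h2 := hfd k w
    have h3 := dist_triangle4 (f w) ((s k).1 w) ((s k).1 z) (f z)
    rw [dist_comm (f w) ((s k).1 w), dist_comm ((s k).1 w) ((s k).1 z)] at h3
    have h4 : (2 * M + (D + 1)) * (1 / 2 : ℝ) ^ k = M / 2 ^ k + M / 2 ^ k + (D + 1) / 2 ^ k := by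
      rw [one_div, inv_pow]; ring
    change dist ((s k).1 z) ((s k).1 w) ≤ (D + 1) / 2 ^ k at hw
    linarith
  · have h1 : Tendsto (fun k => dist ((s k).1 z) (h z)) atTop (𝓝 (dist (f z) (h z))) :=
      (hf z).dist tendsto_const_nhds
    have h2 : ∀ k, dist ((s k).1 z) (h z) = 0 := fun k => by rw [(s k).2.2 z hz, dist_self]
    simp only [h2] at h1
    exact dist_eq_zero.1 (tendsto_nhds_unique h1 tendsto_const_nhds)

/-- A path connected complete metric space that fills quadrangles at all scales is simply
connected. -/
theorem simplyConnectedSpace_of_fillsQuadrangles {T : Type*} [MetricSpace T] [CompleteSpace T]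
    [PathConnectedSpace T] {E : T → T → I → T} {A C : ℝ} (hE : FillsQuadrangles E A C)
    (hA : 0 ≤ A) : SimplyConnectedSpace T := by
  classical
  rw [simply_connected_iff_paths_homotopic']
  refine ⟨inferInstance, fun {x y} p q => ?_⟩
  let h : I × I → T := fun z => if z.1 = 0 then p z.2 else if z.1 = 1 then q z.2 else
    if z.2 = 0 then x else y
  have hh : ContinuousOn h squareBoundary := by
    have c1 : IsClosed {z : I × I | z.1 = 0} := isClosed_eq (by fun_prop) continuous_const
    have c2 : IsClosed {z : I × I | z.1 = 1} := isClosed_eq (by fun_prop) continuous_const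
    have c3 : IsClosed {z : I × I | z.2 = 0} := isClosed_eq (by fun_prop) continuous_const
    have c4 : IsClosed {z : I × I | z.2 = 1} := isClosed_eq (by fun_prop) continuous_const
    have h1 : ContinuousOn h {z | z.1 = 0} :=
      (Continuous.continuousOn (f := fun z : I × I => p z.2) (by fun_prop)).congr
        fun z hz => by rw [Set.mem_ofPred_eq] at hz; simp [h, hz]
    have h2 : ContinuousOn h {z | z.1 = 1} :=
      (Continuous.continuousOn (f := fun z : I × I => q z.2) (by fun_prop)).congr
        fun z hz => by rw [Set.mem_ofPred_eq] at hz; simp [h, hz]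
    have h3 : ContinuousOn h {z | z.2 = 0} :=
      (continuousOn_const (c := x)).congr
        fun z hz => by rw [Set.mem_ofPred_eq] at hz; simp [h, hz]
    have h4 : ContinuousOn h {z | z.2 = 1} :=
      (continuousOn_const (c := y)).congr
        fun z hz => by rw [Set.mem_ofPred_eq] at hz; simp [h, hz]
    exact (h1.union_of_isClosed h2 c1 c2).union_of_isClosed (h3.union_of_isClosed h4 c3 c4)
      (c1.union c2) (c3.union c4)
  obtain ⟨f, hf, hfh⟩ := exists_continuous_extension hE hA hh
  refine ⟨⟨⟨⟨f, hf⟩, fun t => ?_, fun t => ?_⟩, fun s t ht => ?_⟩⟩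
  · exact (hfh (0, t) (by simp [squareBoundary])).trans (by simp [h])
  · exact (hfh (1, t) (by simp [squareBoundary])).trans (by simp [h])
  · rcases ht with rfl | ht
    · refine (hfh (s, 0) (by simp [squareBoundary])).trans ?_
      simp only [h]
      split_ifs <;> simp
    · rw [Set.mem_singleton_iff] at ht
      subst ht
      refine (hfh (s, 1) (by simp [squareBoundary])).trans ?_
      simp only [h]
      split_ifs <;> simp_all

end

/-! ### Asymptotic cones: completeness and paths -/

section

theorem dist_mk_le {ι M : Type*} [MetricSpace M] {c : ConeData ι M} {x y : ConeSeq c} {D : ℝ}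
    {d : ι → ℝ} (hd : Tendsto d c.ω (𝓝 D))
    (h : ∀ᶠ i in (c.ω : Filter ι), c.scale i * dist (x.pt i) (y.pt i) ≤ d i) :
    dist (SeparationQuotient.mk x : AsymptoticCone c) (SeparationQuotient.mk y) ≤ D := by
  rw [SeparationQuotient.dist_mk]
  exact le_of_tendsto_of_tendsto (x.tendsto_dist y) hd h

theorem mk_eq_mk_of_eventually {ι M : Type*} [MetricSpace M] {c : ConeData ι M} {x y : ConeSeq c}
    (h : ∀ᶠ i in (c.ω : Filter ι), x.pt i = y.pt i) :
    (SeparationQuotient.mk x : AsymptoticCone c) = SeparationQuotient.mk y := by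
  refine dist_le_zero.1 (dist_mk_le (d := fun _ => 0) tendsto_const_nhds ?_)
  filter_upwards [h] with i hi
  rw [hi, dist_self, mul_zero]

/-- Asymptotic cones are complete, by a diagonal argument; the scaling factors, which are positive
and tend to `0`, show that the ultrafilter is countably incomplete. -/
instance {ι M : Type*} [MetricSpace M] (c : ConeData ι M) : CompleteSpace (ConeSeq c) := by
  classical
  have hB : ∀ n : ℕ, (0 : ℝ) < 1 / (n + 1) := fun n => by positivity
  refine Metric.complete_of_convergent_controlled_sequences (fun n => 1 / ((n : ℝ) + 1)) hB ?_
  intro u hu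
  let P : ι → ℕ → Prop := fun i N => c.scale i < 1 / ((N : ℝ) + 1) ∧ ∀ n ≤ N, ∀ m ≤ N, n ≤ m →
    c.scale i * dist ((u n).pt i) ((u m).pt i) < 1 / ((n : ℝ) + 1)
  have hP : ∀ N, ∀ᶠ i in (c.ω : Filter ι), P i N := by
    intro N
    have h1 : ∀ᶠ i in (c.ω : Filter ι), ∀ n ∈ Finset.range (N + 1), ∀ m ∈ Finset.range (N + 1),
        n ≤ m → c.scale i * dist ((u n).pt i) ((u m).pt i) < 1 / ((n : ℝ) + 1) := by
      refine (Finset.eventually_all _).2 fun n _ => (Finset.eventually_all _).2 fun m _ => ?_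
      by_cases hnm : n ≤ m
      · have h2 := ((u n).tendsto_dist (u m)).eventually (gt_mem_nhds (hu n n m le_rfl hnm))
        exact h2.mono fun i hi _ => hi
      · exact Eventually.of_forall fun i hi => absurd hi hnm
    filter_upwards [h1, c.tendsto_scale.eventually (gt_mem_nhds (hB N))] with i hi hs
    exact ⟨hs, fun n hn m hm => hi n (Finset.mem_range_succ_iff.2 hn) m
      (Finset.mem_range_succ_iff.2 hm)⟩
  let K : ι → ℕ := fun i => Nat.findGreatest (P i) ⌈1 / c.scale i⌉₊
  have hK : ∀ i N, P i N → N ≤ K i ∧ P i (K i) := by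
    intro i N h
    have hb : N ≤ ⌈1 / c.scale i⌉₊ := by
      have h1 : (N : ℝ) + 1 < 1 / c.scale i := by
        rw [lt_one_div (by positivity) (c.scale_pos i)]
        exact h.1
      have h2 : (N : ℝ) ≤ ⌈1 / c.scale i⌉₊ := by linarith [Nat.le_ceil (1 / c.scale i)]
      exact_mod_cast h2
    exact ⟨Nat.le_findGreatest hb h, Nat.findGreatest_spec hb h⟩
  have hz : ∀ n, ∀ᶠ i in (c.ω : Filter ι),
      c.scale i * dist ((u n).pt i) ((u (K i)).pt i) ≤ 1 / ((n : ℝ) + 1) := by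
    intro n
    filter_upwards [hP n] with i hi
    obtain ⟨h1, h2⟩ := hK i n hi
    exact (h2.2 n h1 _ le_rfl h1).le
  let z : ConeSeq c := ⟨fun i => (u (K i)).pt i, by
    obtain ⟨B, hB⟩ := (u 0).bounded
    refine ⟨1 / (((0 : ℕ) : ℝ) + 1) + B, ?_⟩
    filter_upwards [hB, hz 0] with i h1 h2
    have h3 := mul_le_mul_of_nonneg_left
      (dist_triangle_left ((u (K i)).pt i) (c.base i) ((u 0).pt i)) (c.scale_pos i).le
    rw [mul_add] at h3
    linarith⟩
  refine ⟨z, ?_⟩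
  have hd : ∀ n, dist (u n) z ≤ 1 / ((n : ℝ) + 1) := fun n =>
    le_of_tendsto_of_tendsto ((u n).tendsto_dist z) tendsto_const_nhds (hz n)
  rw [tendsto_iff_dist_tendsto_zero]
  exact squeeze_zero (fun _ => dist_nonneg) hd tendsto_one_div_add_atTop_nhds_zero_nat

section Words

variable {G : Type*}

/-- The prefix of the reduced word of `u` that makes up the proportion `s` of its length. -/
def wordPortion {X : Finset G} (u : FreeGroup X) (s : ℝ) : FreeGroup X :=
  wordPrefix u ⌊s * len X u⌋₊

theorem wordPortion_zero {X : Finset G} (u : FreeGroup X) : wordPortion u 0 = 1 := by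
  simp [wordPortion, wordPrefix_zero]

theorem wordPortion_one {X : Finset G} (u : FreeGroup X) : wordPortion u 1 = u := by
  simp [wordPortion, wordPrefix_len]

theorem len_wordPortion_step {X : Finset G} (u : FreeGroup X) {s t : ℝ} (hs : 0 ≤ s)
    (h : s ≤ t) :
    (len X ((wordPortion u s)⁻¹ * wordPortion u t) : ℝ) ≤ (t - s) * len X u + 1 := by
  have h1 : s * len X u ≤ t * len X u := by gcongr
  have h2 := len_wordPrefix_step u (Nat.floor_le_floor h1)
  have h3 : (len X ((wordPortion u s)⁻¹ * wordPortion u t) : ℝ) ≤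
      ((⌊t * len X u⌋₊ - ⌊s * len X u⌋₊ : ℕ) : ℝ) := by exact_mod_cast h2
  rw [Nat.cast_sub (Nat.floor_le_floor h1)] at h3
  have h4 := Nat.floor_le (a := t * len X u) (by have := hs.trans h; positivity)
  have h5 := Nat.lt_floor_add_one (s * len X u)
  linarith

end Words

variable {G : Type*} [Group G]

theorem wordDist_wordPortion_le {X : Finset G} (hX : Subgroup.closure (X : Set G) = ⊤)
    (g : G) (u : FreeGroup X) {s t : ℝ} (hs : 0 ≤ s) (ht : 0 ≤ t) :
    wordDist X (g * eval X (wordPortion u s)) (g * eval X (wordPortion u t)) ≤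
      |s - t| * len X u + 1 := by
  rcases le_total s t with h | h
  · rw [abs_sub_comm, abs_of_nonneg (by linarith)]
    exact (wordDist_mul_eval_mul_eval_le X g _ _).trans (len_wordPortion_step u hs h)
  · rw [abs_of_nonneg (by linarith), wordDist_comm hX]
    exact (wordDist_mul_eval_mul_eval_le X g _ _).trans (len_wordPortion_step u ht h)

section Paths

variable {Y : Finset G} {hY : Subgroup.closure (Y : Set G) = ⊤} {ι : Type*}
  {c : ConeData ι (WordSpace Y hY)}

/-- A chosen family of group elements that represents a point of the cone. -/
def conePt (p : AsymptoticCone c) (i : ι) : G :=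
  (SeparationQuotient.surjective_mk p).choose.pt i

theorem coneSeq_bounded_of_wordDist (p : AsymptoticCone c) (y : ι → G)
    (h : ∃ B, ∀ᶠ i in (c.ω : Filter ι), c.scale i * wordDist Y (conePt p i) (y i) ≤ B) :
    ∃ B : ℝ, ∀ᶠ i in (c.ω : Filter ι), c.scale i * wordDist Y (y i) (c.base i) ≤ B := by
  obtain ⟨A, hA⟩ := (SeparationQuotient.surjective_mk p).choose.bounded
  obtain ⟨B, hB⟩ := h
  refine ⟨B + A, ?_⟩
  filter_upwards [hA, hB] with i h1 h2
  have h3 := mul_le_mul_of_nonneg_left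
    (wordDist_triangle hY (y i) (conePt p i) (c.base i)) (c.scale_pos i).le
  have h4 := wordDist_comm hY (y i) (conePt p i)
  rw [mul_add, h4] at h3
  exact h3.trans (add_le_add h2 h1)

/-- The point of the cone represented by a family of group elements at bounded rescaled distance
from a given point. -/
def coneMk (p : AsymptoticCone c) (y : ι → G)
    (h : ∃ B, ∀ᶠ i in (c.ω : Filter ι), c.scale i * wordDist Y (conePt p i) (y i) ≤ B) :
    AsymptoticCone c :=
  SeparationQuotient.mk ⟨y, coneSeq_bounded_of_wordDist p y h⟩

theorem dist_coneMk_le {p q : AsymptoticCone c} {y z : ι → G} {hy hz} {D : ℝ} {d : ι → ℝ}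
    (hd : Tendsto d c.ω (𝓝 D))
    (h : ∀ᶠ i in (c.ω : Filter ι), c.scale i * wordDist Y (y i) (z i) ≤ d i) :
    dist (coneMk p y hy) (coneMk q z hz) ≤ D :=
  dist_mk_le hd h

theorem coneMk_congr {p q : AsymptoticCone c} {y z : ι → G} {hy hz}
    (h : ∀ᶠ i in (c.ω : Filter ι), y i = z i) : coneMk p y hy = coneMk q z hz :=
  mk_eq_mk_of_eventually h

theorem coneMk_eq {p q : AsymptoticCone c} {y : ι → G} {hy}
    (h : ∀ᶠ i in (c.ω : Filter ι), y i = conePt q i) : coneMk p y hy = q := by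
  conv_rhs => rw [← (SeparationQuotient.surjective_mk q).choose_spec]
  exact mk_eq_mk_of_eventually h

theorem tendsto_dist_conePt (p q : AsymptoticCone c) :
    Tendsto (fun i => c.scale i * wordDist Y (conePt p i) (conePt q i)) c.ω (𝓝 (dist p q)) := by
  have h := (SeparationQuotient.surjective_mk p).choose.tendsto_dist
    (SeparationQuotient.surjective_mk q).choose
  have e : dist p q = dist (SeparationQuotient.surjective_mk p).choose
      (SeparationQuotient.surjective_mk q).choose := by
    conv_lhs => rw [← (SeparationQuotient.surjective_mk p).choose_spec,
      ← (SeparationQuotient.surjective_mk q).choose_spec]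
    exact SeparationQuotient.dist_mk _ _
  rw [e]
  exact h

theorem dist_coneMk_left_le {p : AsymptoticCone c} {y : ι → G} {hy} {D : ℝ}
    (h : ∀ᶠ i in (c.ω : Filter ι), c.scale i * wordDist Y (conePt p i) (y i) ≤ D) :
    dist p (coneMk p y hy) ≤ D := by
  have h1 : coneMk p (conePt p) ⟨0, by simp [wordDist_self]⟩ = p :=
    coneMk_eq (Eventually.of_forall fun _ => rfl)
  calc dist p (coneMk p y hy) = dist (coneMk p (conePt p) ⟨0, by simp [wordDist_self]⟩)
        (coneMk p y hy) := by rw [h1]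
    _ ≤ D := dist_coneMk_le tendsto_const_nhds h

variable {X : Finset G} (hX : Subgroup.closure (X : Set G) = ⊤)

/-- A shortest word over `X` between the `i`-th members of the representatives of two points of
the cone. -/
def coneWord (p q : AsymptoticCone c) (i : ι) : FreeGroup X :=
  (exists_word hX ((conePt p i)⁻¹ * conePt q i)).choose

theorem conePt_mul_eval_coneWord (p q : AsymptoticCone c) (i : ι) :
    conePt p i * eval X (coneWord hX p q i) = conePt q i := by
  rw [coneWord, (exists_word hX _).choose_spec.1, mul_inv_cancel_left]

theorem len_coneWord (p q : AsymptoticCone c) (i : ι) :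
    (len X (coneWord hX p q i) : ℝ) = wordDist X (conePt p i) (conePt q i) := by
  rw [coneWord, (exists_word hX _).choose_spec.2]
  rfl

theorem scale_mul_wordDist_le {L L' : ℝ} (hL0 : 0 ≤ L)
    (hL : ∀ g h : G, wordDist Y g h ≤ L * wordDist X g h)
    (hL' : ∀ g h : G, wordDist X g h ≤ L' * wordDist Y g h) (p q : AsymptoticCone c) (s t : I)
    (i : ι) :
    c.scale i * wordDist Y (conePt p i * eval X (wordPortion (coneWord hX p q i) s))
      (conePt p i * eval X (wordPortion (coneWord hX p q i) t)) ≤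
      L * (|(s : ℝ) - t| * (L' * (c.scale i * wordDist Y (conePt p i) (conePt q i))) +
        c.scale i) := by
  have h0 := (c.scale_pos i).le
  have h1 := wordDist_wordPortion_le hX (conePt p i) (coneWord hX p q i) s.2.1 t.2.1
  rw [len_coneWord] at h1
  have h2 := mul_le_mul_of_nonneg_left (hL' (conePt p i) (conePt q i))
    (abs_nonneg ((s : ℝ) - t))
  calc c.scale i * wordDist Y _ _ ≤ c.scale i * (L * (|(s : ℝ) - t| * (L' *
        wordDist Y (conePt p i) (conePt q i)) + 1)) := by
        refine mul_le_mul_of_nonneg_left ((hL _ _).trans ?_) h0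
        exact mul_le_mul_of_nonneg_left (h1.trans (by linarith)) hL0
    _ = _ := by ring

theorem tendsto_scale_mul_wordDist (L L' : ℝ) (p q : AsymptoticCone c) (s t : I) :
    Tendsto (fun i => L * (|(s : ℝ) - t| * (L' * (c.scale i * wordDist Y (conePt p i)
      (conePt q i))) + c.scale i)) c.ω (𝓝 (L * L' * dist p q * |(s : ℝ) - t|)) := by
  have hlim := ((((tendsto_dist_conePt p q).const_mul L').const_mul |(s : ℝ) - t|).add
    c.tendsto_scale).const_mul L
  have e : L * (|(s : ℝ) - t| * (L' * dist p q) + 0) = L * L' * dist p q * |(s : ℝ) - t| := by ring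
  rwa [e] at hlim

theorem coneWord_bounded (p q : AsymptoticCone c) (s : I) :
    ∃ B, ∀ᶠ i in (c.ω : Filter ι), c.scale i * wordDist Y (conePt p i)
      (conePt p i * eval X (wordPortion (coneWord hX p q i) s)) ≤ B := by
  obtain ⟨L, hL1, hL⟩ := exists_wordDist_le X hX Y hY
  obtain ⟨L', hL1', hL'⟩ := exists_wordDist_le Y hY X hX
  refine ⟨L * L' * dist p q * |((0 : I) : ℝ) - s| + 1, ((tendsto_scale_mul_wordDist L L' p q 0 s).eventually
    (gt_mem_nhds (lt_add_one _))).mono fun i hi => ?_⟩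
  have h := scale_mul_wordDist_le hX (by linarith) hL hL' p q 0 s i
  rw [Set.Icc.coe_zero, wordPortion_zero, map_one, mul_one] at h
  exact h.trans hi.le

/-- The point at parameter `s` on the path from `p` to `q` which is the limit of the shortest
words over `X` between their representatives. -/
def conePath (p q : AsymptoticCone c) (s : I) : AsymptoticCone c :=
  coneMk p (fun i => conePt p i * eval X (wordPortion (coneWord hX p q i) s))
    (coneWord_bounded hX p q s)

theorem conePath_zero (p q : AsymptoticCone c) : conePath hX p q 0 = p :=
  coneMk_eq (Eventually.of_forall fun i => by
    rw [Set.Icc.coe_zero, wordPortion_zero, map_one, mul_one])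

theorem conePath_one (p q : AsymptoticCone c) : conePath hX p q 1 = q :=
  coneMk_eq (Eventually.of_forall fun i => by
    rw [Set.Icc.coe_one, wordPortion_one, conePt_mul_eval_coneWord])

theorem dist_conePath_le {L L' : ℝ} (hL0 : 0 ≤ L)
    (hL : ∀ g h : G, wordDist Y g h ≤ L * wordDist X g h)
    (hL' : ∀ g h : G, wordDist X g h ≤ L' * wordDist Y g h) (p q : AsymptoticCone c) (s t : I) :
    dist (conePath hX p q s) (conePath hX p q t) ≤ L * L' * dist p q * |(s : ℝ) - t| :=
  dist_coneMk_le (tendsto_scale_mul_wordDist L L' p q s t)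
    (Eventually.of_forall (scale_mul_wordDist_le hX hL0 hL hL' p q s t))

include hX in
theorem pathConnectedSpace_asymptoticCone : PathConnectedSpace (AsymptoticCone c) := by
  obtain ⟨L, hL1, hL⟩ := exists_wordDist_le X hX Y hY
  obtain ⟨L', hL1', hL'⟩ := exists_wordDist_le Y hY X hX
  refine ⟨⟨SeparationQuotient.mk ⟨c.base, 0, by simp⟩⟩, fun p q => ⟨⟨⟨conePath hX p q, ?_⟩,
    conePath_zero hX p q, conePath_one hX p q⟩⟩⟩
  refine (LipschitzWith.of_dist_le_mul (K := (L * L' * dist p q).toNNReal) fun s t => ?_).continuous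
  rw [Real.coe_toNNReal _ (by positivity)]
  exact dist_conePath_le hX (by linarith) hL hL' p q s t

end Paths

end

/-! ### Filling quadrangles in the cone -/

section

/-- A map to a clique complex becomes `D`-continuous if every point is replaced by the vertex
carrying its largest barycentric coordinate and the vertices are mapped to a metric space in which
adjacent vertices are `D`-close. -/
theorem exists_quasiContinuous_of_cliqueComplex {J Z T : Type*} [Fintype J] [TopologicalSpace Z]
    [PseudoMetricSpace T] (Γ : SimpleGraph J) (v : J → T) {D : ℝ} (hD : 0 ≤ D)
    (hv : ∀ u w, Γ.Adj u w → dist (v u) (v w) ≤ D) (S : C(Z, cliqueComplex Γ)) :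
    ∃ f : Z → T, QuasiContinuous D f ∧ ∀ z, ∃ u, (S z : J → ℝ) u ≠ 0 ∧ f z = v u := by
  have hpos : ∀ z, ∃ u, 0 < (S z : J → ℝ) u := by
    intro z
    by_contra! h
    have h1 : ∑ u, (S z : J → ℝ) u ≤ 0 := Finset.sum_nonpos fun u _ => h u
    rw [(S z).2.1.2] at h1
    linarith
  have hmax : ∀ z, ∃ u, ∀ w, (S z : J → ℝ) w ≤ (S z : J → ℝ) u := by
    intro z
    obtain ⟨u₀, _⟩ := hpos z
    obtain ⟨u, -, hu⟩ := Finset.exists_max_image Finset.univ (S z : J → ℝ) ⟨u₀, Finset.mem_univ _⟩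
    exact ⟨u, fun w => hu w (Finset.mem_univ _)⟩
  choose m hm using hmax
  have hm0 : ∀ z, (S z : J → ℝ) (m z) ≠ 0 := by
    intro z
    obtain ⟨u, hu⟩ := hpos z
    exact (hu.trans_le (hm z u)).ne'
  refine ⟨fun z => v (m z), fun z => ?_, fun z => ⟨m z, hm0 z, rfl⟩⟩
  -- Near `z`, the largest coordinate is at a vertex of the simplex carrying `S z`.
  have hev : ∀ᶠ w in 𝓝 z, ∀ u, (S z : J → ℝ) u = 0 → (S w : J → ℝ) u < (S w : J → ℝ) (m z) := by
    refine eventually_all.2 fun u => ?_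
    by_cases hu : (S z : J → ℝ) u = 0
    · have hc : ∀ u, Continuous fun w => (S w : J → ℝ) u := fun u =>
        (continuous_apply u).comp (continuous_subtype_val.comp S.continuous)
      have h1 : (S z : J → ℝ) u < (S z : J → ℝ) (m z) := by
        rw [hu]
        exact lt_of_le_of_ne ((S z).2.1.1 _) (hm0 z).symm
      have h2 : ∀ᶠ w in 𝓝 z, (S w : J → ℝ) u < (S w : J → ℝ) (m z) :=
        (isOpen_lt (hc u) (hc (m z))).mem_nhds h1
      exact h2.mono fun w hw _ => hw
    · exact Eventually.of_forall fun w h => absurd h hu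
  filter_upwards [hev] with w hw
  have h1 : (S z : J → ℝ) (m w) ≠ 0 := fun h => absurd (hm w (m z)) (not_le.2 (hw _ h))
  by_cases h2 : m z = m w
  · rw [h2, dist_self]; exact hD
  · exact hv _ _ ((S z).2.2 (hm0 z) h1 h2)

/-- The prefix of `u` sampled at the `j`-th of `k` equidistant parameters. -/
def wordSample {X : Finset G} (u : FreeGroup X) (k j : ℕ) : FreeGroup X :=
  wordPortion u (((min j k : ℕ) : ℝ) / k)

section

variable {G : Type*} {X : Finset G}

theorem wordSample_zero (u : FreeGroup X) (k : ℕ) : wordSample u k 0 = 1 := by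
  simp [wordSample, wordPortion_zero]

theorem wordSample_of_le (u : FreeGroup X) {k j : ℕ} (hk : 0 < k) (h : k ≤ j) :
    wordSample u k j = u := by
  have : (k : ℝ) ≠ 0 := by positivity
  rw [wordSample, min_eq_right h, div_self this, wordPortion_one]

theorem len_wordSample_step (u : FreeGroup X) {k : ℕ} (hk : 0 < k) (j : ℕ) :
    (len X ((wordSample u k j)⁻¹ * wordSample u k (j + 1)) : ℝ) ≤ len X u / k + 1 := by
  have hk' : (0 : ℝ) < k := by exact_mod_cast hk
  have h1 : ((min j k : ℕ) : ℝ) ≤ (min (j + 1) k : ℕ) := by exact_mod_cast (by omega)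
  have h2 : ((min (j + 1) k : ℕ) : ℝ) ≤ (min j k : ℕ) + 1 := by exact_mod_cast (by omega)
  refine (len_wordPortion_step u (by positivity) (by gcongr)).trans ?_
  have h3 : (((min (j + 1) k : ℕ) : ℝ) / k - ((min j k : ℕ) : ℝ) / k) ≤ 1 / k := by
    rw [← sub_div]; gcongr; linarith
  have h4 := mul_le_mul_of_nonneg_right h3 (Nat.cast_nonneg (len X u))
  rw [one_div_mul_eq_div] at h4
  linarith

end

variable {G : Type*} [Group G]

/-- The coarse fillings of quadrangles in the group, at a single index of the cone. -/
theorem exists_coarse_quadrangle (X : Finset G) (hX : Subgroup.closure (X : Set G) = ⊤)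
    {k : ℕ} (hk : 0 < k) (N : ℕ) {ρ D : ℝ} (hρ : 1 ≤ ρ) (hD : D / k + 1 ≤ ρ)
    (hfill : ∀ w : FreeGroup X, eval X w = 1 → (len X w : ℝ) ≤ 4 * D →
      ∃ l ≤ N, IsProdOfConj {R | eval X R = 1 ∧ (len X R : ℝ) ≤ ρ} w l)
    {g₀₀ g₁₀ g₀₁ g₁₁ : G} {b r l t : FreeGroup X} (hb : g₀₀ * eval X b = g₁₀)
    (hr : g₁₀ * eval X r = g₁₁) (hl : g₀₀ * eval X l = g₀₁) (ht : g₀₁ * eval X t = g₁₁)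
    (hbD : (len X b : ℝ) ≤ D) (hrD : (len X r : ℝ) ≤ D) (hlD : (len X l : ℝ) ≤ D)
    (htD : (len X t : ℝ) ≤ D) :
    ∃ V : FillIndex k N → G,
      ((∀ j, V (gridIndex k N j 0) = g₀₀ * eval X (wordSample b k j)) ∧
      (∀ j, V (gridIndex k N k j) = g₁₀ * eval X (wordSample r k j)) ∧
      (∀ j, V (gridIndex k N 0 j) = g₀₀ * eval X (wordSample l k j)) ∧
      (∀ j, V (gridIndex k N j k) = g₀₁ * eval X (wordSample t k j))) ∧
      ((∀ j, wordDist X (V (gridIndex k N j 0)) (V (gridIndex k N (j + 1) 0)) ≤ 10 * ρ) ∧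
      (∀ j, wordDist X (V (gridIndex k N k j)) (V (gridIndex k N k (j + 1))) ≤ 10 * ρ) ∧
      (∀ j, wordDist X (V (gridIndex k N 0 j)) (V (gridIndex k N 0 (j + 1))) ≤ 10 * ρ) ∧
      (∀ j, wordDist X (V (gridIndex k N j k)) (V (gridIndex k N (j + 1) k)) ≤ 10 * ρ)) ∧
      (∀ u, Relation.ReflTransGen (fun u v => wordDist X (V u) (V v) ≤ 10 * ρ)
        (gridIndex k N 0 0) u) ∧
      ∀ (Q : Type) [Group Q] (e : FillIndex k N → FillIndex k N → Q),
        (∀ u v z, wordDist X (V u) (V v) ≤ 10 * ρ → wordDist X (V v) (V z) ≤ 10 * ρ →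
          wordDist X (V u) (V z) ≤ 10 * ρ → e u v * e v z = e u z) →
        ((List.range k).map fun j => e (gridIndex k N j 0) (gridIndex k N (j + 1) 0)).prod *
        ((List.range k).map fun j => e (gridIndex k N k j) (gridIndex k N k (j + 1))).prod =
        ((List.range k).map fun j => e (gridIndex k N 0 j) (gridIndex k N 0 (j + 1))).prod *
        ((List.range k).map fun j => e (gridIndex k N j k) (gridIndex k N (j + 1) k)).prod := by
  have hstep : ∀ u : FreeGroup X, (len X u : ℝ) ≤ D → ∀ j,
      (len X ((wordSample u k j)⁻¹ * wordSample u k (j + 1)) : ℝ) ≤ ρ := by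
    intro u hu j
    refine (len_wordSample_step u hk j).trans (le_trans ?_ hD)
    gcongr
  have hstep' : ∀ u z : FreeGroup X, (len X u : ℝ) ≤ D → ∀ j,
      (len X ((z * wordSample u k j)⁻¹ * (z * wordSample u k (j + 1))) : ℝ) ≤ ρ := by
    intro u z hu j
    rw [show (z * wordSample u k j)⁻¹ * (z * wordSample u k (j + 1)) =
      (wordSample u k j)⁻¹ * wordSample u k (j + 1) by group]
    exact hstep u hu j
  have hkk : ∀ u : FreeGroup X, wordSample u k k = u := fun u => wordSample_of_le u hk le_rfl
  have heval : eval X (b * r) = eval X (l * t) := by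
    have h1 : g₀₀ * eval X (b * r) = g₀₀ * eval X (l * t) := by
      rw [map_mul, map_mul, ← mul_assoc, ← mul_assoc, hb, hr, hl, ht]
    exact mul_left_cancel h1
  have hw : ∃ n ≤ N, IsProdOfConj {R | eval X R = 1 ∧ (len X R : ℝ) ≤ ρ}
      (b * wordSample r k k * (l * wordSample t k k)⁻¹) n := by
    rw [hkk, hkk]
    refine hfill _ (by rw [map_mul, map_inv, heval, mul_inv_cancel]) ?_
    have h1 := len_mul_le X (b * r) (l * t)⁻¹
    have h2 := len_mul_le X b r
    have h3 := len_mul_le X l t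
    rw [len_inv] at h1
    have h4 : (len X (b * r * (l * t)⁻¹) : ℝ) ≤ len X b + len X r + (len X l + len X t) := by
      exact_mod_cast h1.trans (add_le_add h2 h3)
    linarith
  obtain ⟨V, hVb, hVr, hVl, hVt, hconn, hQ⟩ := exists_coarse_filling X hX k N hρ g₀₀
    (wordSample b k) (fun j => b * wordSample r k j) (wordSample l k)
    (fun j => l * wordSample t k j) (wordSample_zero b k) (wordSample_zero l k)
    (by rw [wordSample_zero, mul_one, hkk]) (by rw [wordSample_zero, mul_one, hkk])
    (by simp only [hkk]; exact heval) (hstep b hbD) (hstep' r b hrD) (hstep l hlD) (hstep' t l htD)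
    (fun j hj => by rw [hkk, wordSample_of_le b hk hj])
    (fun j hj => by rw [hkk, wordSample_of_le r hk hj])
    (fun j hj => by rw [hkk, wordSample_of_le l hk hj])
    (fun j hj => by rw [hkk, wordSample_of_le t hk hj]) hw
  have hd : ∀ (q : ℕ → FreeGroup X), (∀ j, (len X ((q j)⁻¹ * q (j + 1)) : ℝ) ≤ ρ) → ∀ j,
      wordDist X (g₀₀ * eval X (q j)) (g₀₀ * eval X (q (j + 1))) ≤ 10 * ρ := by
    intro q hq j
    linarith [wordDist_mul_eval_mul_eval_le X g₀₀ (q j) (q (j + 1)), hq j]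
  refine ⟨V, ⟨hVb, fun j => ?_, hVl, fun j => ?_⟩, ⟨fun j => ?_, fun j => ?_, fun j => ?_,
    fun j => ?_⟩, hconn, hQ⟩
  · rw [hVr, map_mul, ← mul_assoc, hb]
  · rw [hVt, map_mul, ← mul_assoc, hl]
  · rw [hVb, hVb]; exact hd _ (hstep b hbD) j
  · rw [hVr, hVr]; exact hd _ (hstep' r b hrD) j
  · rw [hVl, hVl]; exact hd _ (hstep l hlD) j
  · rw [hVt, hVt]; exact hd _ (hstep' t l htD) j

/-- Asymptotic cones of groups with spectrum dominated by a function of `n / m` fill quadrangles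
at all scales. -/
theorem exists_fillsQuadrangles (hG : Group.IsFinitelyPresented G)
    (X : Finset G) (hX : Subgroup.closure (X : Set G) = ⊤)
    (g : ℚ → ℝ) (hg : MonotoneOn g (Set.Ioi 0))
    (hfg : Dominated (fun k m n => (spectrum X k m n : ℝ)) (fun _ m n => g ((n : ℚ) / (m : ℚ))))
    (Y : Finset G) (hY : Subgroup.closure (Y : Set G) = ⊤)
    {ι : Type*} (c : ConeData ι (WordSpace Y hY)) :
    ∃ A C : ℝ, 0 ≤ A ∧ FillsQuadrangles (T := AsymptoticCone c) (conePath hX) A C := by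
  classical
  obtain ⟨L, hL1, hL⟩ := exists_wordDist_le X hX Y hY
  obtain ⟨L', hL1', hL'⟩ := exists_wordDist_le Y hY X hX
  have hlip := dist_conePath_le (c := c) hX (by linarith) hL hL'
  -- Relations are cut into pieces `α` times as long as the sides, and the sides into `k` pieces.
  set α : ℝ := 1 / (800 * L) with hα
  have hα0 : 0 < α := by positivity
  obtain ⟨N, t₀, ht₀, hfill⟩ := exists_isProdOfConj_of_dominated hG X hX g hg hfg hα0
    (b := 4 * (2 * L')) (by positivity)
  obtain ⟨m, hm⟩ := pow_unbounded_of_one_lt (max (4 * L' / α) (80 * (L * L'))) one_lt_two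
  have hm1 : 4 * L' / α < 2 ^ m := (le_max_left _ _).trans_lt hm
  have hm2 : 80 * (L * L') < 2 ^ m := (le_max_right _ _).trans_lt hm
  set k : ℕ := 2 ^ m with hk
  have hkR : (k : ℝ) = 2 ^ m := by rw [hk]; push_cast; rfl
  have hk0 : 0 < k := by positivity
  have hk0' : (0 : ℝ) < k := by exact_mod_cast hk0
  set J := FillIndex k N with hJ
  refine ⟨L * L', Fintype.card J * (10 * (L * α)) + 1, by positivity, ⟨fun p q s => ?_, ?_⟩⟩
  · have h1 := hlip p q 0 s
    rw [conePath_zero] at h1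
    refine h1.trans (mul_le_of_le_one_right (by positivity) ?_)
    rw [Set.Icc.coe_zero, zero_sub, abs_neg, abs_of_nonneg s.2.1]
    exact s.2.2
  intro ε hε p₀₀ p₁₀ p₀₁ p₁₁ hb hr hl ht
  let ρ : ι → ℝ := fun i => α * ε / c.scale i
  have hlen : ∀ p q : AsymptoticCone c, dist p q ≤ ε →
      ∀ᶠ i in (c.ω : Filter ι), (len X (coneWord hX p q i) : ℝ) ≤ 2 * L' * ε / c.scale i := by
    intro p q hpq
    filter_upwards [(tendsto_dist_conePt p q).eventually
      (gt_mem_nhds (by linarith : dist p q < 2 * ε))] with i hi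
    rw [len_coneWord, le_div_iff₀ (c.scale_pos i)]
    calc wordDist X (conePt p i) (conePt q i) * c.scale i
        ≤ (L' * wordDist Y (conePt p i) (conePt q i)) * c.scale i :=
          mul_le_mul_of_nonneg_right (hL' _ _) (c.scale_pos i).le
      _ = L' * (c.scale i * wordDist Y (conePt p i) (conePt q i)) := by ring
      _ ≤ L' * (2 * ε) := by gcongr
      _ = 2 * L' * ε := by ring
  -- Coarse fillings at almost all indices.
  obtain ⟨V, hV⟩ := Eventually.choice (l := (c.ω : Filter ι)) (r := fun i (V : J → G) =>
      1 ≤ ρ i ∧ ((∀ j, V (gridIndex k N j 0) =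
        conePt p₀₀ i * eval X (wordSample (coneWord hX p₀₀ p₁₀ i) k j)) ∧
      (∀ j, V (gridIndex k N k j) =
        conePt p₁₀ i * eval X (wordSample (coneWord hX p₁₀ p₁₁ i) k j)) ∧
      (∀ j, V (gridIndex k N 0 j) =
        conePt p₀₀ i * eval X (wordSample (coneWord hX p₀₀ p₀₁ i) k j)) ∧
      (∀ j, V (gridIndex k N j k) =
        conePt p₀₁ i * eval X (wordSample (coneWord hX p₀₁ p₁₁ i) k j))) ∧
      ((∀ j, wordDist X (V (gridIndex k N j 0)) (V (gridIndex k N (j + 1) 0)) ≤ 10 * ρ i) ∧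
      (∀ j, wordDist X (V (gridIndex k N k j)) (V (gridIndex k N k (j + 1))) ≤ 10 * ρ i) ∧
      (∀ j, wordDist X (V (gridIndex k N 0 j)) (V (gridIndex k N 0 (j + 1))) ≤ 10 * ρ i) ∧
      (∀ j, wordDist X (V (gridIndex k N j k)) (V (gridIndex k N (j + 1) k)) ≤ 10 * ρ i)) ∧
      (∀ u, Relation.ReflTransGen (fun u v => wordDist X (V u) (V v) ≤ 10 * ρ i)
        (gridIndex k N 0 0) u) ∧
      ∀ (Q : Type) [Group Q] (e : J → J → Q),
        (∀ u v z, wordDist X (V u) (V v) ≤ 10 * ρ i → wordDist X (V v) (V z) ≤ 10 * ρ i →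
          wordDist X (V u) (V z) ≤ 10 * ρ i → e u v * e v z = e u z) →
        ((List.range k).map fun j => e (gridIndex k N j 0) (gridIndex k N (j + 1) 0)).prod *
        ((List.range k).map fun j => e (gridIndex k N k j) (gridIndex k N k (j + 1))).prod =
        ((List.range k).map fun j => e (gridIndex k N 0 j) (gridIndex k N 0 (j + 1))).prod *
        ((List.range k).map fun j => e (gridIndex k N j k) (gridIndex k N (j + 1) k)).prod) (by
    have hsmall : 0 < min (min (α * ε / 2) 1) (t₀ * ε) := by positivity
    filter_upwards [hlen _ _ hb, hlen _ _ hr, hlen _ _ hl, hlen _ _ ht,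
      c.tendsto_scale.eventually (gt_mem_nhds hsmall)] with i h1 h2 h3 h4 hs
    have hs0 := c.scale_pos i
    have hs1 : c.scale i ≤ α * ε / 2 :=
      (hs.trans_le ((min_le_left _ _).trans (min_le_left _ _))).le
    have hs2 : c.scale i ≤ t₀ * ε := (hs.trans_le (min_le_right _ _)).le
    have hρ2 : 2 ≤ ρ i := by
      simp only [ρ]
      rw [le_div_iff₀ hs0]
      linarith
    refine exists_and_left.2 ⟨by linarith, ?_⟩
    refine exists_coarse_quadrangle X hX hk0 N (ρ := ρ i) (D := 2 * L' * ε / c.scale i)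
      (by linarith) ?_ ?_ (conePt_mul_eval_coneWord hX _ _ i) (conePt_mul_eval_coneWord hX _ _ i)
      (conePt_mul_eval_coneWord hX _ _ i) (conePt_mul_eval_coneWord hX _ _ i) h1 h2 h3 h4
    · have h5 : 2 * L' * ε / c.scale i / k ≤ ρ i / 2 := by
        simp only [ρ]
        rw [div_le_iff₀ hk0', hkR]
        rw [div_lt_iff₀ hα0] at hm1
        calc 2 * L' * ε / c.scale i = (4 * L') * (ε / c.scale i / 2) := by ring
          _ ≤ (2 ^ m * α) * (ε / c.scale i / 2) := by gcongr
          _ = _ := by ring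
      linarith
    · intro w hw hwl
      have h6 := hfill (c.scale i / ε) (by positivity) (by rwa [div_le_iff₀ hε]) w hw
        (hwl.trans (le_of_eq (by field_simp)))
      have h7 : α / (c.scale i / ε) = ρ i := by simp only [ρ]; field_simp
      rwa [h7] at h6)
  -- The finite complexes are eventually constant along the ultrafilter.
  let Γ : SimpleGraph J :=
    { Adj := fun u v => u ≠ v ∧ ∀ᶠ i in (c.ω : Filter ι), wordDist X (V i u) (V i v) ≤ 10 * ρ i
      symm := ⟨fun u v h => ⟨h.1.symm, h.2.mono fun i hi => by rwa [wordDist_comm hX]⟩⟩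
      loopless := ⟨fun u h => h.1 rfl⟩ }
  obtain ⟨i₀, hi₀, hΓ⟩ : ∃ i, (1 ≤ ρ i ∧ _) ∧ ∀ u v : J,
      (∀ᶠ i in (c.ω : Filter ι), wordDist X (V i u) (V i v) ≤ 10 * ρ i) ↔
      wordDist X (V i u) (V i v) ≤ 10 * ρ i := by
    refine (hV.and (eventually_all.2 fun u => eventually_all.2 fun v => ?_)).exists
    by_cases huv : ∀ᶠ i in (c.ω : Filter ι), wordDist X (V i u) (V i v) ≤ 10 * ρ i
    · exact huv.mono fun i hi => ⟨fun _ => hi, fun _ => huv⟩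
    · exact (Ultrafilter.eventually_not.2 huv).mono fun i hi =>
        ⟨fun h => absurd h huv, fun h => absurd h hi⟩
  have hclique : ∀ u v : J, Γ.IsClique {u, v} ↔ wordDist X (V i₀ u) (V i₀ v) ≤ 10 * ρ i₀ := by
    intro u v
    rw [SimpleGraph.isClique_pair, ← hΓ]
    refine ⟨fun h => ?_, fun h huv => ⟨huv, h⟩⟩
    by_cases huv : u = v
    · subst huv
      filter_upwards [hV] with i hi
      rw [wordDist_self]
      linarith [hi.1]
    · exact (h huv).2
  obtain ⟨hρ₀, -, ⟨hab, har, hal, hat⟩, hconn, hQ⟩ := hi₀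
  have hreach : ∀ u, Γ.Reachable (gridIndex k N 0 0) u := by
    intro u
    induction hconn u with
    | refl => exact SimpleGraph.Reachable.refl _
    | @tail a b _ hab ih =>
      by_cases h : a = b
      · rw [← h]; exact ih
      · exact ih.trans (SimpleGraph.Adj.reachable
          ((SimpleGraph.isClique_pair.1 ((hclique a b).2 hab)) h))
  obtain ⟨S, hSb, hSr, hSl, hSt⟩ := exists_square_cliqueComplex Γ m
    (fun j => gridIndex k N j 0) (fun j => gridIndex k N k j) (fun j => gridIndex k N 0 j)
    (fun j => gridIndex k N j k) hreach
    (fun j => (hclique _ _).2 (hab j)) (fun j => (hclique _ _).2 (har j))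
    (fun j => (hclique _ _).2 (hal j)) (fun j => (hclique _ _).2 (hat j)) rfl rfl rfl rfl
    (fun Q _ e he => hQ Q e fun u v z h1 h2 h3 =>
      he u v z ((hclique _ _).2 h1) ((hclique _ _).2 h2) ((hclique _ _).2 h3))
  -- The vertices of the complex as points of the cone.
  have hscale : ∀ i, c.scale i * (L * (10 * ρ i)) = 10 * (L * α) * ε := by
    intro i
    have := (c.scale_pos i).ne'
    simp only [ρ]
    field_simp
  have hVd : ∀ u, ∀ᶠ i in (c.ω : Filter ι), c.scale i * wordDist Y (conePt p₀₀ i) (V i u) ≤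
      Fintype.card J * (10 * (L * α)) * ε := by
    intro u
    filter_upwards [hV] with i hi
    obtain ⟨hρi, ⟨hVb, -⟩, -, hconn, -⟩ := hi
    have h0 : V i (gridIndex k N 0 0) = conePt p₀₀ i := by
      rw [hVb, wordSample_zero, map_one, mul_one]
    have h1 := dist_le_of_reflTransGen (d := fun u v => wordDist X (V i u) (V i v))
      (fun u => wordDist_self X _) (fun u v => wordDist_comm hX _ _)
      (fun u v z => wordDist_triangle hX _ _ _) (by linarith : 0 ≤ 10 * ρ i) (hconn u)
    rw [h0] at h1
    calc c.scale i * wordDist Y (conePt p₀₀ i) (V i u)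
        ≤ c.scale i * (L * (Fintype.card J * (10 * ρ i))) := by
          refine mul_le_mul_of_nonneg_left ((hL _ _).trans ?_) (c.scale_pos i).le
          exact mul_le_mul_of_nonneg_left h1 (by linarith)
      _ = Fintype.card J * (c.scale i * (L * (10 * ρ i))) := by ring
      _ = _ := by rw [hscale]; ring
  let v : J → AsymptoticCone c := fun u => coneMk p₀₀ (fun i => V i u) ⟨_, hVd u⟩
  have hvd : ∀ u, dist p₀₀ (v u) ≤ Fintype.card J * (10 * (L * α)) * ε := fun u =>
    dist_coneMk_left_le (hVd u)
  have h80 : 10 * (L * α) * ε = ε / 80 := by rw [hα]; field_simp; norm_num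
  have hvadj : ∀ u w, Γ.Adj u w → dist (v u) (v w) ≤ ε / 80 := by
    intro u w huw
    refine dist_coneMk_le tendsto_const_nhds (huw.2.mono fun i hi => ?_)
    rw [← h80, ← hscale i]
    refine mul_le_mul_of_nonneg_left ((hL _ _).trans ?_) (c.scale_pos i).le
    exact mul_le_mul_of_nonneg_left hi (by linarith)
  obtain ⟨F₀, hF₀q, hF₀v⟩ := exists_quasiContinuous_of_cliqueComplex Γ v (by positivity) hvadj S
  have hpathv : ∀ (p q : AsymptoticCone c) (a : ℕ → J), dist p q ≤ ε →
      (∀ᶠ i in (c.ω : Filter ι), ∀ j,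
        V i (a j) = conePt p i * eval X (wordSample (coneWord hX p q i) k j)) →
      ∀ (x : I) (j : ℕ), j < k → (j : ℝ) ≤ 2 ^ m * x → 2 ^ m * x ≤ (j : ℝ) + 1 → ∀ z,
        Function.support (S z : J → ℝ) ⊆ {a j, a (j + 1)} →
        dist (F₀ z) (conePath hX p q x) ≤ ε / 80 := by
    intro p q a hpq ha x j hj hx1 hx2 z hz
    have hvE : ∀ j', j' ≤ k → ∀ y : I, (y : ℝ) = j' / k → v (a j') = conePath hX p q y := by
      intro j' hj' y hy
      refine coneMk_congr (ha.mono fun i hi => ?_)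
      rw [hi j', wordSample, min_eq_left hj', hy]
    have hclose : ∀ j', j' ≤ k → |(j' : ℝ) - 2 ^ m * x| ≤ 1 →
        dist (v (a j')) (conePath hX p q x) ≤ ε / 80 := by
      intro j' hj' hd
      have hmem : (j' : ℝ) / k ∈ I := ⟨by positivity, by
        rw [div_le_one hk0']; exact_mod_cast hj'⟩
      rw [hvE j' hj' ⟨_, hmem⟩ rfl]
      refine (hlip p q _ x).trans ?_
      have h1 : |(j' : ℝ) / k - x| ≤ 1 / k := by
        have h2 : (j' : ℝ) / k - x = (j' - 2 ^ m * x) / k := by rw [← hkR]; field_simp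
        rw [h2, abs_div, abs_of_pos hk0']
        gcongr
      calc L * L' * dist p q * |(j' : ℝ) / k - x| ≤ L * L' * ε * (1 / k) := by gcongr
        _ = (80 * (L * L')) * ε / 80 / k := by ring
        _ ≤ 2 ^ m * ε / 80 / k := by gcongr
        _ = ε / 80 := by rw [hkR]; field_simp
    obtain ⟨u, hu, hFu⟩ := hF₀v z
    rw [hFu]
    rcases hz hu with h | h
    · rw [h]
      exact hclose j hj.le (by rw [abs_le]; constructor <;> linarith)
    · rw [Set.mem_singleton_iff.1 h]
      refine hclose (j + 1) hj ?_
      push_cast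
      rw [abs_le]
      constructor <;> linarith
  have eb : ∀ x, dist (F₀ (x, 0)) (conePath hX p₀₀ p₁₀ x) ≤ ε / 80 := by
    intro x
    obtain ⟨j, h1, h2, h3, h4⟩ := hSb x
    exact hpathv _ _ _ hb (hV.mono fun i hi => hi.2.1.1) x j h1 h2 h3 _ h4
  have er : ∀ y, dist (F₀ (1, y)) (conePath hX p₁₀ p₁₁ y) ≤ ε / 80 := by
    intro y
    obtain ⟨j, h1, h2, h3, h4⟩ := hSr y
    exact hpathv _ _ _ hr (hV.mono fun i hi => hi.2.1.2.1) y j h1 h2 h3 _ h4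
  have el : ∀ y, dist (F₀ (0, y)) (conePath hX p₀₀ p₀₁ y) ≤ ε / 80 := by
    intro y
    obtain ⟨j, h1, h2, h3, h4⟩ := hSl y
    exact hpathv _ _ _ hl (hV.mono fun i hi => hi.2.1.2.2.1) y j h1 h2 h3 _ h4
  have et : ∀ x, dist (F₀ (x, 1)) (conePath hX p₀₁ p₁₁ x) ≤ ε / 80 := by
    intro x
    obtain ⟨j, h1, h2, h3, h4⟩ := hSt x
    exact hpathv _ _ _ ht (hV.mono fun i hi => hi.2.1.2.2.2) x j h1 h2 h3 _ h4
  let F : I × I → AsymptoticCone c := fun z =>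
    if z.2 = 0 then conePath hX p₀₀ p₁₀ z.1 else if z.2 = 1 then conePath hX p₀₁ p₁₁ z.1 else
    if z.1 = 0 then conePath hX p₀₀ p₀₁ z.2 else if z.1 = 1 then conePath hX p₁₀ p₁₁ z.2 else F₀ z
  have hFF : ∀ z, dist (F₀ z) (F z) ≤ ε / 80 := by
    rintro ⟨x, y⟩
    simp only [F]
    split_ifs with h1 h2 h3 h4
    · subst h1; exact eb x
    · subst h2; exact et x
    · subst h3; exact el y
    · subst h4; exact er y
    · rw [dist_self]; positivity
  refine ⟨F, (hF₀q.of_dist_le hFF).mono (by linarith), fun x => by simp [F], fun x => by simp [F],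
    fun y => ?_, fun y => ?_, fun z => ?_⟩
  · simp only [F]
    split_ifs with h1 h2
    · rw [h1, conePath_zero, conePath_zero]
    · rw [h2, conePath_zero, conePath_one]
    · rfl
  · simp only [F]
    split_ifs with h1 h2 h3
    · rw [h1, conePath_one, conePath_zero]
    · rw [h2, conePath_one, conePath_one]
    · exact absurd h3 one_ne_zero
    · rfl
  · obtain ⟨u, -, hu⟩ := hF₀v z
    have h1 := dist_triangle p₀₀ (F₀ z) (F z)
    have h2 := hvd u
    rw [← hu] at h2
    have h3 := hFF z
    linarith

end

end IsoSpectrum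

end

open IsoSpectrum in
theorem proposition2p16 {G : Type*} [Group G] (hG : Group.IsFinitelyPresented G)
    (X : Finset G) (hX : Subgroup.closure (X : Set G) = ⊤)
    (g : ℚ → ℝ) (hg : MonotoneOn g (Set.Ioi 0))
    (hfg : Dominated (fun k m n => (spectrum X k m n : ℝ)) (fun _ m n => g ((n : ℚ) / (m : ℚ))))
    (Y : Finset G) (hY : Subgroup.closure (Y : Set G) = ⊤)
    {ι : Type*} (c : ConeData ι (WordSpace Y hY)) :
    SimplyConnectedSpace (AsymptoticCone c) := by
  obtain ⟨A, C, hA, hE⟩ := exists_fillsQuadrangles hG X hX g hg hfg Y hY c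
  have := pathConnectedSpace_asymptoticCone hX (c := c)
  exact simplyConnectedSpace_of_fillsQuadrangles hE hA
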